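/- Work in ZF, without the Axiom of Choice (that is, the following is a theorem of ZF; equivalently, it holds inside every model of ZF). Notation. For a limit ordinal $\lambda$ and an ordinal $\theta$, let $C^{\lambda}_{\{\theta\}}=\{\delta<\lambda : \mathrm{cf}(\delta)=\theta\}$. For a set $x$ of ordinals, $\mathrm{o.t.}(x)$ is its ordertype and, for $\eta<\mathrm{o.t.}(x)$, $x(\eta)$ is the $\eta$-th member of $x$, i.e. the unique $\alpha\in x$ with $\mathrm{o.t.}(x\cap\alpha)=\eta$. For a sequence $\bar C=\langle c_\delta:\delta\in S\rangle$ of sets of ordinals, $S^{\eta}_{\alpha,\beta}(\bar C)$ is the set of $\delta\in S$ such that $\mathrm{o.t.}(c_\delta)>\eta$ and $\alpha\le c_\delta(\eta)<\beta$. For an ordinal $\gamma$, $\mathrm{AC}_\gamma$ says that for every sequence $\langle X_a:a<\gamma\rangle$ of nonempty sets there is a function $f$ with domain $\gamma$ such that $f(a)\in X_a$ for all $a<\gamma$. A subset of $\lambda$ is stationary if it meets every closed unbounded (club) subset of $\lambda$. A function $F$ on a set of ordinals is regressive if $F(\delta)<\delta$ for every $\delta$ in its domain. Theorem. Suppose that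 $\theta<\lambda$ are regular uncountable cardinals, that $\gamma\in[\theta,\lambda)$ is an ordinal, and that $\bar C=\langle c_\delta:\delta\in C^{\lambda}_{\{\theta\}}\rangle$ is a sequence such that each $c_\delta$ is a cofinal subset of $\delta$ of ordertype less than or equal to $\gamma$. Then at least one of the following holds. 1. There exist $\eta<\gamma$ and a continuous (strictly) increasing sequence $\langle\alpha_\xi:\xi<\lambda\rangle$ of elements of $\lambda$ such that for every $\xi<\lambda$ the set $S^{\eta}_{\alpha_\xi,\alpha_{\xi+1}}(\bar C)$ is a stationary subset of $\lambda$. 2. Both of the following statements hold. (a) For some club $E\subseteq\lambda$ there is a regressive function $F$ on $E\cap C^{\lambda}_{\{\theta\}}$ such that $F^{-1}\{\beta\}$ is not stationary in $\lambda$ for any $\beta<\lambda$. (b) If $\mathrm{AC}_\gamma$ holds, then for some $\alpha_*<\lambda$ there is a regressive function $G$ on $C^{\lambda}_{\{\theta\}}\setminus(\alpha_*+1)$ such that for each $\beta<\lambda$ the set $\{\delta\in C^{\lambda}_{\{\theta\}}\setminus(\alpha_*+1) : G(\delta)<\beta\}$ is not stationary in $\lambda$. -/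

import Mathlib

/-!
"Working in ZF" is read semantically: the result is asserted inside every model `(M, ∈ₘ)` of the
first-order theory ZF, well-founded or not, in every universe. Everything below is interpreted
inside such a model: all quantifiers range over elements of `M`, and all sets, functions, sequences
and bijections of the mathematics are elements of `M`. So the choice principle of the
metatheory gives no choice inside `M`. The type `Set M` is used only for classes of `M` that are
given by explicit first-order formulas with parameters.
-/

namespace ZFInternal

/-- The only symbol of the language of set theory: the binary relation symbol for membership. -/
inductive SetRel : ℕ → Type
  | mem : SetRel 2

/-- The first-order language of set theory. -/
def setLanguage : FirstOrder.Language.{0, 0} := ⟨fun _ => Empty, SetRel⟩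

variable {M : Type*} [setLanguage.Structure M]

/-- Membership of the structure `M`. -/
def Mem (x y : M) : Prop :=
  FirstOrder.Language.Structure.RelMap (L := setLanguage) (M := M) (n := 2) SetRel.mem ![x, y]

infix:50 " ∈ₘ " => Mem

/-- `M` is a model of ZF (Zermelo-Fraenkel set theory with Foundation, without Choice). The two
schemas range over the formulas of the language of set theory with parameters from `M`. -/
class ZFModel (M : Type*) [setLanguage.Structure M] : Prop where
  extensionality : ∀ a b : M, (∀ x, x ∈ₘ a ↔ x ∈ₘ b) → a = b
  foundation : ∀ a : M, (∃ x, x ∈ₘ a) → ∃ x, x ∈ₘ a ∧ ∀ y, y ∈ₘ a → ¬ y ∈ₘ x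
  pairing : ∀ a b : M, ∃ c, ∀ x, x ∈ₘ c ↔ x = a ∨ x = b
  union : ∀ a : M, ∃ b, ∀ x, x ∈ₘ b ↔ ∃ y, y ∈ₘ a ∧ x ∈ₘ y
  power : ∀ a : M, ∃ b, ∀ x, x ∈ₘ b ↔ ∀ y, y ∈ₘ x → y ∈ₘ a
  infinity : ∃ a : M, (∃ e, e ∈ₘ a ∧ ∀ x, ¬ x ∈ₘ e) ∧
    ∀ x, x ∈ₘ a → ∃ y, y ∈ₘ a ∧ ∀ z, z ∈ₘ y ↔ z ∈ₘ x ∨ z = x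
  separation : ∀ P : Set M, Set.Definable₁ Set.univ setLanguage P →
    ∀ a : M, ∃ b, ∀ x, x ∈ₘ b ↔ x ∈ₘ a ∧ x ∈ P
  replacement : ∀ R : Set (M × M), Set.Definable₂ Set.univ setLanguage R →
    ∀ a : M, (∀ x, x ∈ₘ a → ∃! y, (x, y) ∈ R) → ∃ b, ∀ y, y ∈ₘ b ↔ ∃ x, x ∈ₘ a ∧ (x, y) ∈ R

/-- The class of all elements of the set `a`. -/
def elts (a : M) : Set M := {x | x ∈ₘ a}

/-! ### Ordinals -/

/-- `a` is an ordinal: a transitive set of transitive sets (by Foundation, this is the same as a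
transitive set which is well-ordered by membership). -/
def IsOrd (a : M) : Prop :=
  (∀ x, x ∈ₘ a → ∀ y, y ∈ₘ x → y ∈ₘ a) ∧
    ∀ x, x ∈ₘ a → ∀ y, y ∈ₘ x → ∀ z, z ∈ₘ y → z ∈ₘ x

/-- `a ≤ b`, for ordinals. The strict order is `a ∈ₘ b`. -/
def Le (a b : M) : Prop := a ∈ₘ b ∨ a = b

/-- `s = a + 1`. -/
def IsSucc (s a : M) : Prop := ∀ z, z ∈ₘ s ↔ z ∈ₘ a ∨ z = a

/-- `a` is a (nonzero) limit ordinal. -/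
def IsLimit (a : M) : Prop :=
  IsOrd a ∧ (∃ x, x ∈ₘ a) ∧ ∀ x, x ∈ₘ a → ∃ y, y ∈ₘ a ∧ x ∈ₘ y

/-- `w` is the ordinal `ω`, the least limit ordinal. -/
def IsOmega (w : M) : Prop := IsLimit w ∧ ∀ x, x ∈ₘ w → ¬ IsLimit x

/-! ### Functions -/

/-- `p` is the ordered pair `(x, y) = {{x}, {x, y}}`. -/
def IsPair (p x y : M) : Prop :=
  ∀ z, z ∈ₘ p ↔ (∀ w, w ∈ₘ z ↔ w = x) ∨ (∀ w, w ∈ₘ z ↔ w = x ∨ w = y)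

/-- `(x, y) ∈ f`. When `f` is a function, this says `f(x) = y`. -/
def Maps (f x y : M) : Prop := ∃ p, IsPair p x y ∧ p ∈ₘ f

/-- `f` is a function with domain `D`. -/
def IsFunOn (f : M) (D : Set M) : Prop :=
  (∀ p, p ∈ₘ f → ∃ x y, IsPair p x y ∧ x ∈ D) ∧ ∀ x, x ∈ D → ∃! y, Maps f x y

/-- `f` is a function with domain `D` and all its values are in `R`. -/
def IsFunInto (f : M) (D R : Set M) : Prop :=
  IsFunOn f D ∧ ∀ x y, Maps f x y → y ∈ R

/-! ### Cofinality and order types -/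

/-- `f` is a function from `a` to `d` with range cofinal in `d`. -/
def IsCofinalMap (f a d : M) : Prop :=
  IsFunInto f (elts a) (elts d) ∧
    ∀ x, x ∈ₘ d → ∃ ξ y, Maps f ξ y ∧ Le x y

/-- `cf(d) = k`: `k` is the least ordinal from which there is a function cofinal in the
ordinal `d`. -/
def IsCof (d k : M) : Prop :=
  IsOrd d ∧ IsOrd k ∧ (∃ f, IsCofinalMap f k d) ∧ ∀ a, a ∈ₘ k → ¬ ∃ f, IsCofinalMap f a d

/-- `k` is a regular uncountable cardinal: an ordinal above `ω` with `cf(k) = k` (such an ordinal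
is not in bijection with any smaller one, hence is a cardinal). -/
def IsRegularUncountable (k : M) : Prop :=
  IsOrd k ∧ (∃ w, IsOmega w ∧ w ∈ₘ k) ∧ IsCof k k

/-- The ordinals below `lam` of cofinality `θ`. -/
def cofPoints (lam θ : M) : Set M := {δ | δ ∈ₘ lam ∧ IsCof δ θ}

/-- `o.t.(X) = τ`, for `X` consisting of ordinals: some increasing function maps the ordinal `τ`
onto `X`. -/
def HasOrderType (X : Set M) (τ : M) : Prop :=
  IsOrd τ ∧ ∃ f, IsFunInto f (elts τ) X ∧ (∀ x, x ∈ X → ∃ ξ, Maps f ξ x) ∧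
    ∀ ξ ζ x y, Maps f ξ x → Maps f ζ y → ξ ∈ₘ ζ → x ∈ₘ y

/-- `x` is the `η`-th member of the set of ordinals `c`: `x ∈ c` and `o.t.(c ∩ x) = η`. -/
def IsNth (c η x : M) : Prop := x ∈ₘ c ∧ HasOrderType {y | y ∈ₘ c ∧ y ∈ₘ x} η

/-- `c` is a cofinal subset of `d`. -/
def IsCofinalSubset (c d : M) : Prop :=
  (∀ x, x ∈ₘ c → x ∈ₘ d) ∧ ∀ x, x ∈ₘ d → ∃ y, y ∈ₘ c ∧ Le x y

/-! ### Clubs and stationary sets -/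

/-- `D` is a closed unbounded subset of `lam`. -/
def IsClubIn (lam D : M) : Prop :=
  (∀ x, x ∈ₘ D → x ∈ₘ lam) ∧
  (∀ x, x ∈ₘ lam → ∃ y, y ∈ₘ D ∧ x ∈ₘ y) ∧
  ∀ δ, δ ∈ₘ lam → IsLimit δ → (∀ x, x ∈ₘ δ → ∃ y, y ∈ₘ D ∧ x ∈ₘ y ∧ y ∈ₘ δ) → δ ∈ₘ D

/-- `A` is a stationary subset of `lam`: a subset of `lam` that meets every club subset of `lam`. -/
def IsStationaryIn (lam : M) (A : Set M) : Prop :=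
  A ⊆ elts lam ∧ ∀ D, IsClubIn lam D → ∃ δ, δ ∈ₘ D ∧ δ ∈ A

/-! ### Ladder systems -/

/-- `c` is a sequence `⟨c_δ : δ < lam, cf(δ) = θ⟩` such that each `c_δ` is a cofinal subset of `δ`
of order type at most `γ`. -/
def IsLadderSystem (lam θ γ c : M) : Prop :=
  IsFunOn c (cofPoints lam θ) ∧
    ∀ δ d, Maps c δ d → IsCofinalSubset d δ ∧ ∃ τ, HasOrderType (elts d) τ ∧ Le τ γ

/-- `S^η_{α,β}(c)`: the `δ` in the domain of `c` with `o.t.(c_δ) > η` and `α ≤ c_δ(η) < β`. -/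
def splitSet (c η α β : M) : Set M :=
  {δ | ∃ d, Maps c δ d ∧ (∃ τ, HasOrderType (elts d) τ ∧ η ∈ₘ τ) ∧
    ∃ x, IsNth d η x ∧ Le α x ∧ x ∈ₘ β}

/-- `s` is a continuous (strictly) increasing sequence `⟨s_ξ : ξ < lam⟩` of elements of `lam`. -/
def IsContinuousIncreasing (lam s : M) : Prop :=
  IsFunInto s (elts lam) (elts lam) ∧
  (∀ ξ ζ x y, Maps s ξ x → Maps s ζ y → ξ ∈ₘ ζ → x ∈ₘ y) ∧
  ∀ ξ y, IsLimit ξ → Maps s ξ y → ∀ z, z ∈ₘ y ↔ ∃ ζ u, ζ ∈ₘ ξ ∧ Maps s ζ u ∧ z ∈ₘ u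

/-- `F` is a regressive function with domain `D`. -/
def IsRegressiveOn (F : M) (D : Set M) : Prop :=
  IsFunOn F D ∧ ∀ δ y, Maps F δ y → y ∈ₘ δ

/-- The choice principle `AC_Z`: every sequence `⟨X_a : a ∈ Z⟩` of nonempty sets has a choice
function. -/
def ACFor (Z : M) : Prop :=
  ∀ X, IsFunOn X (elts Z) → (∀ a x, Maps X a x → ∃ y, y ∈ₘ x) →
    ∃ f, IsFunOn f (elts Z) ∧ ∀ a x y, Maps X a x → Maps f a y → y ∈ₘ x

end ZFInternal

open ZFInternal

/-! Fix `η < γ` and ask whether every `α < lam` has some `β < lam` with `S^η_{α,β}` stationary. If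
some `η` has this property, the limit ordinals closed under `α ↦ β` form a club, and its continuous
enumeration gives the first alternative, since raising the right endpoint keeps stationarity
(`exists_club_closed`, `exists_enumeration`). Otherwise each `η` fails from some `α` on, and as `γ <
lam` regularity gives one `αstar` for all `η` (`exists_uniform_bound`): every `S^η_{αstar,β}` is
nonstationary. Let `F δ` code a pair `(x, η)` with `x ≥ αstar` the `η`-th point of `c_δ`. A value of
`F` determines both `η` and `x`, so each fiber lies in a single `S^η_{αstar,β}`; restricting to a
club closed under the coding makes `F` regressive. Let `G δ` be a point of `c_δ` that is at least
`αstar`. Then `{G < β}` lies in the union of the `S^η_{αstar,β}` over `η < γ`; choosing `γ` many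
disjoint clubs to intersect is the one use of `AC_γ`. Elsewhere a selection of witnesses is replaced
by taking least ordinals, so each such selection must be given by a formula. -/

namespace ZFInternal

universe u

set_option synthInstance.maxSize 100000
set_option synthInstance.maxHeartbeats 200000

/-! ### Definability with parameters, as needed for Separation and Replacement. -/

section Definability

/-! ### Definable predicates

A context is an iterated product of copies of `M`. Definability (with parameters) of predicates on
contexts is derived by instance search. -/

/-- `α` is a finite product of copies of `M`; `DefMap f` says that all coordinates of `f` are
definable functions. -/
class Ctx (M : Type u) [setLanguage.Structure M] (α : Type u) where
  DefMap : ∀ {n : ℕ}, ((Fin n → M) → α) → Prop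
  defMap_comp_castSucc : ∀ {n : ℕ} {f : (Fin n → M) → α}, DefMap f →
    DefMap fun w : Fin (n + 1) → M => f fun i => w i.castSucc

variable {M : Type u} [setLanguage.Structure M]

instance Ctx.base : Ctx M M where
  DefMap f := Set.univ.DefinableFun setLanguage f
  defMap_comp_castSucc hf := hf.comp fun _ => Set.DefinableFun.proj _

instance Ctx.prod {α β : Type u} [Ctx M α] [Ctx M β] : Ctx M (α × β) where
  DefMap f := Ctx.DefMap (M := M) (fun v => (f v).1) ∧ Ctx.DefMap (M := M) (fun v => (f v).2)
  defMap_comp_castSucc hf := ⟨Ctx.defMap_comp_castSucc hf.1, Ctx.defMap_comp_castSucc hf.2⟩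

/-- `t` is a definable map between contexts. -/
class DefTerm (M : Type u) [setLanguage.Structure M] {α β : Type u} [Ctx M α] [Ctx M β]
    (t : α → β) : Prop where
  out : ∀ {n : ℕ} {f : (Fin n → M) → α}, Ctx.DefMap (M := M) f → Ctx.DefMap (M := M) fun v => t (f v)

/-- `P` is a predicate definable with parameters. -/
class Def (M : Type u) [setLanguage.Structure M] {α : Type u} [Ctx M α] (P : α → Prop) : Prop where
  out : ∀ {n : ℕ} {f : (Fin n → M) → α}, Ctx.DefMap (M := M) f →
    Set.univ.Definable setLanguage {v | P (f v)}

/-- `X` is a family of classes that is definable with parameters. -/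
class DefSet (M : Type u) [setLanguage.Structure M] {α : Type u} [Ctx M α] (X : α → Set M) :
    Prop where
  out : Def M fun p : α × M => p.2 ∈ X p.1

section terms

variable {α β δ : Type u} [Ctx M α] [Ctx M β] [Ctx M δ]

instance DefTerm.id : DefTerm M fun a : α => a := ⟨fun h => h⟩

instance DefTerm.fst (t : α → β × δ) [h : DefTerm M t] : DefTerm M fun a => (t a).1 :=
  ⟨fun hf => (h.out hf).1⟩

instance DefTerm.snd (t : α → β × δ) [h : DefTerm M t] : DefTerm M fun a => (t a).2 :=
  ⟨fun hf => (h.out hf).2⟩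

instance DefTerm.pair (t : α → β) (s : α → δ) [ht : DefTerm M t] [hs : DefTerm M s] :
    DefTerm M fun a => (t a, s a) :=
  ⟨fun hf => ⟨ht.out hf, hs.out hf⟩⟩

instance DefTerm.const (c : M) : DefTerm M fun _ : α => c :=
  ⟨fun {n _} _ => setLanguage.definableFun_const (Fin n) (Set.mem_univ c)⟩

theorem DefTerm.comp (t : β → δ) (s : α → β) [ht : DefTerm M t] [hs : DefTerm M s] :
    DefTerm M fun a => t (s a) :=
  ⟨fun hf => ht.out (hs.out hf)⟩

theorem Def.comp (P : β → Prop) [h : Def M P] (t : α → β) [ht : DefTerm M t] :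
    Def M fun a => P (t a) :=
  ⟨fun hf => h.out (ht.out hf)⟩

theorem Def.comp₂ (P : β → δ → Prop) [h : Def M fun p : β × δ => P p.1 p.2] (t : α → β)
    (s : α → δ) [DefTerm M t] [DefTerm M s] : Def M fun a => P (t a) (s a) :=
  Def.comp (fun p : β × δ => P p.1 p.2) fun a => (t a, s a)

end terms

section formulas

variable {α : Type u} [Ctx M α]

theorem Def.congr {P Q : α → Prop} (h : Def M Q) (e : ∀ a, P a ↔ Q a) : Def M P := by
  have : P = Q := funext fun a => propext (e a)
  exact this ▸ h

/-- The defined set is everything or empty, so `p` itself need not be a formula of set theory. -/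
instance Def.const (p : Prop) : Def M fun _ : α => p :=
  ⟨fun _ => by by_cases hp : p <;> simp [hp]⟩

instance Def.mem (t s : α → M) [ht : DefTerm M t] [hs : DefTerm M s] :
    Def M fun a => t a ∈ₘ s a := by
  refine ⟨fun {n f} hf => ?_⟩
  have h2 : Set.univ.Definable setLanguage {v : Fin 2 → M | v 0 ∈ₘ v 1} := by
    refine (Set.empty_definable_iff.2 ⟨FirstOrder.Language.Relations.formula₂ (L := setLanguage)
      SetRel.mem (.var 0) (.var 1), ?_⟩).mono (Set.empty_subset _)
    ext v
    exact (FirstOrder.Language.Formula.realize_rel₂ (L := setLanguage) (M := M) (R := SetRel.mem)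
      (t₁ := .var 0) (t₂ := .var 1) (v := v)).symm
  exact h2.preimage_map (F := fun v => ![t (f v), s (f v)])
    (Fin.forall_fin_two.2 ⟨ht.out hf, hs.out hf⟩)

instance Def.eq (t s : α → M) [ht : DefTerm M t] [hs : DefTerm M s] :
    Def M fun a => t a = s a :=
  ⟨fun hf => Set.DefinableFun.ofPred_eq (ht.out hf) (hs.out hf)⟩

instance Def.and (P Q : α → Prop) [hP : Def M P] [hQ : Def M Q] : Def M fun a => P a ∧ Q a :=
  ⟨fun hf => (hP.out hf).inter (hQ.out hf)⟩

instance Def.or (P Q : α → Prop) [hP : Def M P] [hQ : Def M Q] : Def M fun a => P a ∨ Q a :=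
  ⟨fun hf => (hP.out hf).union (hQ.out hf)⟩

instance Def.not (P : α → Prop) [hP : Def M P] : Def M fun a => ¬ P a :=
  ⟨fun hf => (hP.out hf).compl⟩

instance Def.imp (P Q : α → Prop) [Def M P] [Def M Q] : Def M fun a => P a → Q a :=
  Def.congr (inferInstanceAs (Def M fun a => ¬ P a ∨ Q a)) fun _ => imp_iff_not_or

instance Def.iff (P Q : α → Prop) [Def M P] [Def M Q] : Def M fun a => P a ↔ Q a :=
  Def.congr (inferInstanceAs (Def M fun a => (P a → Q a) ∧ (Q a → P a))) fun _ => iff_def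

instance Def.exists (P : α → M → Prop) [hP : Def M fun p : α × M => P p.1 p.2] :
    Def M fun a => ∃ x, P a x := by
  refine ⟨fun {n f} hf => ?_⟩
  -- The witness becomes a fresh last variable; the existential is the image of the resulting
  -- definable set under forgetting that variable.
  have h := (hP.out (f := fun w : Fin (n + 1) → M =>
    (f fun i => w i.castSucc, w (Fin.last n)))
    ⟨Ctx.defMap_comp_castSucc hf, Set.DefinableFun.proj _⟩).image_comp
    (Fin.castSucc : Fin n → Fin (n + 1))
  convert! h using 1
  ext v
  constructor
  · rintro ⟨x, hx⟩
    exact ⟨Fin.snoc v x, by simpa using hx, by ext i; simp⟩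
  · rintro ⟨w, hw, rfl⟩
    exact ⟨_, hw⟩

instance Def.forall (P : α → M → Prop) [Def M fun p : α × M => P p.1 p.2] :
    Def M fun a => ∀ x, P a x :=
  Def.congr (Q := fun a => ¬ ∃ x, ¬ P a x) inferInstance fun _ => by simp

instance Def.existsUnique (P : α → M → Prop) [hP : Def M fun p : α × M => P p.1 p.2]
    [hP' : Def M fun p : (α × M) × M => P p.1.1 p.2] :
    Def M fun a => ∃! x, P a x :=
  inferInstanceAs (Def M fun a => ∃ x, P a x ∧ ∀ y, P a y → y = x)

instance Def.mem_set (t : α → M) (X : α → Set M) [DefTerm M t] [h : DefSet M X] :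
    Def M fun a => t a ∈ X a :=
  have := h.out
  Def.comp₂ (fun a y => y ∈ X a) (fun a => a) t

instance DefSet.setOf (P : α → M → Prop) [h : Def M fun p : α × M => P p.1 p.2] :
    DefSet M fun a => {y | P a y} := ⟨h⟩

instance DefSet.elts (t : α → M) [ht : DefTerm M t] : DefSet M fun a => elts (t a) :=
  have := DefTerm.comp (M := M) t (Prod.fst : α × M → α)
  ⟨Def.mem (fun p : α × M => p.2) fun p => t p.1⟩

theorem DefSet.comp {β : Type u} [Ctx M β] (X : β → Set M) (s : α → β) [h : DefSet M X]
    [hs : DefTerm M s] : DefSet M fun a => X (s a) :=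
  have := h.out
  have := DefTerm.comp (M := M) s (Prod.fst : α × M → α)
  ⟨Def.comp₂ (fun b y => y ∈ X b) (fun p : α × M => s p.1) fun p => p.2⟩

section predicates

-- Composition moves the parameters `t`, `A`, ... into the larger contexts `α × M` created by
-- quantifiers.
attribute [local instance low] DefTerm.comp DefSet.comp

variable (t s r q : α → M) [DefTerm M t] [DefTerm M s] [DefTerm M r] [DefTerm M q]
  (A B : α → Set M) [DefSet M A] [DefSet M B]

instance Def.isOrd : Def M fun a => IsOrd (t a) := by unfold IsOrd; infer_instance

instance Def.le : Def M fun a => Le (t a) (s a) := by unfold Le; infer_instance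

instance Def.isLimit : Def M fun a => IsLimit (t a) := by unfold IsLimit; infer_instance

instance Def.isPair : Def M fun a => IsPair (t a) (s a) (r a) := by
  unfold IsPair; infer_instance

instance Def.maps : Def M fun a => Maps (t a) (s a) (r a) := by unfold Maps; infer_instance

instance Def.isFunOn : Def M fun a => IsFunOn (t a) (A a) := by unfold IsFunOn; infer_instance

instance Def.isFunInto : Def M fun a => IsFunInto (t a) (A a) (B a) := by
  unfold IsFunInto; infer_instance

instance Def.isCofinalMap : Def M fun a => IsCofinalMap (t a) (s a) (r a) := by
  unfold IsCofinalMap; infer_instance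

instance Def.isCof : Def M fun a => IsCof (t a) (s a) := by unfold IsCof; infer_instance

instance Def.hasOrderType : Def M fun a => HasOrderType (A a) (t a) := by
  unfold HasOrderType; infer_instance

instance Def.isNth : Def M fun a => IsNth (t a) (s a) (r a) := by unfold IsNth; infer_instance

instance Def.isClubIn : Def M fun a => IsClubIn (t a) (s a) := by unfold IsClubIn; infer_instance

instance Def.subset_elts : Def M fun a => A a ⊆ elts (t a) :=
  inferInstanceAs (Def M fun a => ∀ x, x ∈ A a → x ∈ₘ t a)

instance Def.isStationaryIn : Def M fun a => IsStationaryIn (t a) (A a) := by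
  unfold IsStationaryIn; infer_instance

instance DefSet.splitSet : DefSet M fun a => splitSet (t a) (s a) (r a) (q a) := by
  unfold ZFInternal.splitSet; infer_instance

end predicates

end formulas

/-! Instances for eta-reduced predicates. -/

section eta

variable (c : M)

instance Def.mem' : Def M (Mem c) := Def.mem (fun _ => c) fun x => x

instance Def.eq' : Def M (Eq c) := Def.eq (fun _ => c) fun x => x

instance Def.le' : Def M (Le c) := Def.le (fun _ => c) fun x => x

instance Def.isClubIn' : Def M (IsClubIn c) := Def.isClubIn (fun _ => c) fun x => x

end eta

end Definability

/-! ### Consequences of the axioms: least ordinals, pairs, functions given by formulas. -/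

section SetTheory

/-! ### Basic set theory inside a model -/

variable {M : Type u} [setLanguage.Structure M]

theorem IsOrd.trans {a x y : M} (ha : IsOrd a) (h : x ∈ₘ y) (h' : y ∈ₘ a) : x ∈ₘ a :=
  ha.1 y h' x h

theorem IsOrd.mem {a x : M} (ha : IsOrd a) (h : x ∈ₘ a) : IsOrd x :=
  ⟨ha.2 x h, fun y hy => ha.2 y (ha.trans hy h)⟩

theorem Le.trans_mem {a b c : M} (h : Le a b) (h' : b ∈ₘ c) (hc : IsOrd c) : a ∈ₘ c := by
  rcases h with h | rfl
  · exact hc.trans h h'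
  · exact h'

theorem mem_of_mem_of_le {a b c : M} (h : a ∈ₘ b) (h' : Le b c) (hc : IsOrd c) : a ∈ₘ c := by
  rcases h' with h' | rfl
  · exact hc.trans h h'
  · exact h

theorem Le.trans {a b c : M} (h : Le a b) (h' : Le b c) (hc : IsOrd c) : Le a c := by
  rcases h' with h' | rfl
  · exact .inl (h.trans_mem h' hc)
  · exact h

theorem IsSucc.isOrd {s a : M} (h : IsSucc s a) (ha : IsOrd a) : IsOrd s := by
  refine ⟨fun x hx y hy => (h y).2 (.inl ?_), fun x hx => ?_⟩
  · rcases (h x).1 hx with hx | rfl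
    · exact ha.trans hy hx
    · exact hy
  · rcases (h x).1 hx with hx | rfl
    · exact ha.2 x hx
    · exact ha.1

variable [ZFModel M]

theorem exists_sep (P : M → Prop) [h : Def M P] (a : M) : ∃ b, ∀ x, x ∈ₘ b ↔ x ∈ₘ a ∧ P x :=
  ZFModel.separation {x | P x} (h.out (Set.DefinableFun.proj _)) a

theorem exists_replacement (R : M → M → Prop) [h : Def M fun p : M × M => R p.1 p.2] (a : M)
    (hR : ∀ x, x ∈ₘ a → ∃! y, R x y) : ∃ b, ∀ y, y ∈ₘ b ↔ ∃ x, x ∈ₘ a ∧ R x y :=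
  ZFModel.replacement {p | R p.1 p.2}
    (h.out (f := fun v : Fin 2 → M => (v 0, v 1))
      ⟨Set.DefinableFun.proj _, Set.DefinableFun.proj _⟩) a hR

theorem exists_minimal (P : M → Prop) [Def M P] {a x : M} (hx : x ∈ₘ a) (hP : P x) :
    ∃ m, m ∈ₘ a ∧ P m ∧ ∀ y, y ∈ₘ a → P y → ¬ y ∈ₘ m := by
  obtain ⟨b, hb⟩ := exists_sep P a
  obtain ⟨m, hm, h⟩ := ZFModel.foundation b ⟨x, (hb x).2 ⟨hx, hP⟩⟩
  exact ⟨m, ((hb m).1 hm).1, ((hb m).1 hm).2, fun y hy hPy => h y ((hb y).2 ⟨hy, hPy⟩)⟩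

theorem mem_asymm {a b : M} (h : a ∈ₘ b) : ¬ b ∈ₘ a := by
  intro h'
  obtain ⟨c, hc⟩ := ZFModel.pairing a b
  obtain ⟨m, hm, h0⟩ := ZFModel.foundation c ⟨a, (hc a).2 (.inl rfl)⟩
  rcases (hc m).1 hm with rfl | rfl
  · exact h0 b ((hc b).2 (.inr rfl)) h'
  · exact h0 a ((hc a).2 (.inl rfl)) h

theorem mem_irrefl (a : M) : ¬ a ∈ₘ a := fun h => mem_asymm h h

/-! ### Ordinals -/

/-- This replaces choice: among ordinals satisfying a formula, the least is again given by a
formula. -/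
theorem IsOrd.exists_least (P : M → Prop) [Def M P] {a : M} (ha : IsOrd a) (h : P a) :
    ∃ m, IsOrd m ∧ P m ∧ Le m a ∧ ∀ y, y ∈ₘ m → ¬ P y := by
  by_cases h' : ∃ x, x ∈ₘ a ∧ P x
  · obtain ⟨x, hx, hPx⟩ := h'
    obtain ⟨m, hm, hPm, hmin⟩ := exists_minimal P hx hPx
    exact ⟨m, ha.mem hm, hPm, .inl hm, fun y hy hPy => hmin y (ha.trans hy hm) hPy hy⟩
  · exact ⟨a, ha, h, .inr rfl, fun y hy hPy => h' ⟨y, hy, hPy⟩⟩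

/-- Take the least `m` incomparable with some ordinal, then the least `k` incomparable with `m`.
Minimality forces `m` and `k` to have the same elements. -/
theorem IsOrd.trichotomy {a b : M} (ha : IsOrd a) (hb : IsOrd b) : a ∈ₘ b ∨ a = b ∨ b ∈ₘ a := by
  by_contra hab
  obtain ⟨m, hm, ⟨n, hn, hmn⟩, -, hmin⟩ := ha.exists_least
    (fun x => ∃ y, IsOrd y ∧ ¬ (x ∈ₘ y ∨ x = y ∨ y ∈ₘ x)) ⟨b, hb, hab⟩
  obtain ⟨k, hk, hmk, -, hkmin⟩ := hn.exists_least
    (fun y => ¬ (m ∈ₘ y ∨ m = y ∨ y ∈ₘ m)) hmn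
  refine hmk (.inr (.inl (ZFModel.extensionality _ _ fun x => ⟨fun hx => ?_, fun hx => ?_⟩)))
  · by_contra hxk
    have := not_exists.1 (hmin x hx) k
    rw [not_and, not_not] at this
    rcases this hk with h | rfl | h
    · exact hxk h
    · exact hmk (.inr (.inr hx))
    · exact hmk (.inr (.inr (hm.trans h hx)))
  · rcases not_not.1 (hkmin x hx) with h | rfl | h
    · exact (hmk (.inl (hk.trans h hx))).elim
    · exact (hmk (.inl hx)).elim
    · exact h

theorem Le.not_mem {a b : M} (h : Le a b) : ¬ b ∈ₘ a := by
  rcases h with h | rfl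
  · exact mem_asymm h
  · exact mem_irrefl a

theorem IsOrd.le_of_not_mem {a b : M} (ha : IsOrd a) (hb : IsOrd b) (h : ¬ a ∈ₘ b) : Le b a := by
  rcases ha.trichotomy hb with h' | rfl | h'
  · exact (h h').elim
  · exact .inr rfl
  · exact .inl h'

theorem IsOrd.mem_or_le {a b : M} (ha : IsOrd a) (hb : IsOrd b) : a ∈ₘ b ∨ Le b a :=
  (em _).imp_right (ha.le_of_not_mem hb)

theorem Le.antisymm {a b : M} (h : Le a b) (h' : Le b a) : a = b :=
  h.resolve_left h'.not_mem

theorem IsOrd.eq_of_not_mem {a b : M} (ha : IsOrd a) (hb : IsOrd b) (h : ¬ a ∈ₘ b)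
    (h' : ¬ b ∈ₘ a) : a = b :=
  (hb.le_of_not_mem ha h').antisymm (ha.le_of_not_mem hb h)

theorem exists_succ (a : M) : ∃ s, IsSucc s a := by
  obtain ⟨c, hc⟩ := ZFModel.pairing a a
  obtain ⟨d, hd⟩ := ZFModel.pairing a c
  obtain ⟨s, hs⟩ := ZFModel.union d
  refine ⟨s, fun z => (hs z).trans ⟨?_, ?_⟩⟩
  · rintro ⟨y, hy, hz⟩
    rcases (hd y).1 hy with rfl | rfl
    · exact .inl hz
    · exact .inr (by simpa using (hc z).1 hz)
  · rintro (h | rfl)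
    · exact ⟨a, (hd a).2 (.inl rfl), h⟩
    · exact ⟨c, (hd c).2 (.inr rfl), (hc z).2 (.inl rfl)⟩

/-! ### Functions -/

theorem exists_isPair (x y : M) : ∃ p, IsPair p x y := by
  obtain ⟨a, ha⟩ := ZFModel.pairing x x
  obtain ⟨b, hb⟩ := ZFModel.pairing x y
  obtain ⟨p, hp⟩ := ZFModel.pairing a b
  simp only [or_self] at ha
  refine ⟨p, fun z => (hp z).trans (or_congr ⟨?_, fun h => ?_⟩ ⟨?_, fun h => ?_⟩)⟩
  · rintro rfl; exact ha
  · exact ZFModel.extensionality _ _ fun w => (h w).trans (ha w).symm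
  · rintro rfl; exact hb
  · exact ZFModel.extensionality _ _ fun w => (h w).trans (hb w).symm

theorem IsPair.unique {p q x y : M} (hp : IsPair p x y) (hq : IsPair q x y) : p = q :=
  ZFModel.extensionality _ _ fun z => (hp z).trans (hq z).symm

theorem IsPair.inj {p x y x' y' : M} (h : IsPair p x y) (h' : IsPair p x' y') :
    x = x' ∧ y = y' := by
  obtain ⟨a, ha⟩ := ZFModel.pairing x x
  obtain ⟨b, hb⟩ := ZFModel.pairing x y
  obtain ⟨b', hb'⟩ := ZFModel.pairing x' y'
  simp only [or_self] at ha
  obtain rfl : x = x' := by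
    rcases (h' a).1 ((h a).2 (.inl ha)) with h1 | h1
    · exact ((ha x').1 ((h1 x').2 rfl)).symm
    · exact ((ha x').1 ((h1 x').2 (.inl rfl))).symm
  refine ⟨rfl, ?_⟩
  have h1 : y = x ∨ y = y' := by
    rcases (h' b).1 ((h b).2 (.inr hb)) with h1 | h1
    · exact .inl ((h1 y).1 ((hb y).2 (.inr rfl)))
    · exact (h1 y).1 ((hb y).2 (.inr rfl))
  have h2 : y' = x ∨ y' = y := by
    rcases (h b').1 ((h' b').2 (.inr hb')) with h1 | h1
    · exact .inl ((h1 y').1 ((hb' y').2 (.inr rfl)))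
    · exact (h1 y').1 ((hb' y').2 (.inr rfl))
  rcases h1 with rfl | rfl
  · rcases h2 with h2 | h2 <;> exact h2.symm
  · rfl

/-- Replacement, applied to `x ↦ (x, y)`, turns a functional formula on a set into a function that
is an element of `M`. -/
theorem exists_graph (A : M) (φ : M → M → Prop) [h : Def M fun p : M × M => φ p.1 p.2]
    (hφ : ∀ x, x ∈ₘ A → ∃! y, φ x y) :
    ∃ f, IsFunOn f (elts A) ∧ ∀ x y, Maps f x y ↔ x ∈ₘ A ∧ φ x y := by
  have inst : Def M fun p : M × M => ∃ y, φ p.1 y ∧ IsPair p.2 p.1 y :=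
    have := Def.comp₂ (M := M) φ (fun q : (M × M) × M => q.1.1) fun q => q.2
    inferInstance
  obtain ⟨f, hf⟩ := exists_replacement (fun x p => ∃ y, φ x y ∧ IsPair p x y) A fun x hx => by
    obtain ⟨y, hy, hu⟩ := hφ x hx
    obtain ⟨p, hp⟩ := exists_isPair x y
    refine ⟨p, ⟨y, hy, hp⟩, ?_⟩
    rintro q ⟨y', hy', hq⟩
    obtain rfl := hu y' hy'
    exact hq.unique hp
  have key : ∀ x y, Maps f x y ↔ x ∈ₘ A ∧ φ x y := by
    refine fun x y => ⟨?_, ?_⟩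
    · rintro ⟨p, hp, hpf⟩
      obtain ⟨x', hx', y', hy', hp'⟩ := (hf p).1 hpf
      obtain ⟨rfl, rfl⟩ := hp.inj hp'
      exact ⟨hx', hy'⟩
    · rintro ⟨hx, hy⟩
      obtain ⟨p, hp⟩ := exists_isPair x y
      exact ⟨p, hp, (hf p).2 ⟨x, hx, y, hy, hp⟩⟩
  refine ⟨f, ⟨fun p hp => ?_, fun x hx => ?_⟩, key⟩
  · obtain ⟨x, hx, y, -, h⟩ := (hf p).1 hp
    exact ⟨x, y, h, hx⟩
  · simpa [key, show x ∈ₘ A from hx] using hφ x hx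

theorem IsFunOn.mem_dom {f x y : M} {D : Set M} (hf : IsFunOn f D) (h : Maps f x y) : x ∈ D := by
  obtain ⟨p, hp, hpf⟩ := h
  obtain ⟨x', y', hp', hx'⟩ := hf.1 p hpf
  exact (hp.inj hp').1 ▸ hx'

theorem IsFunOn.unique {f x y y' : M} {D : Set M} (hf : IsFunOn f D) (h : Maps f x y)
    (h' : Maps f x y') : y = y' :=
  (hf.2 x (hf.mem_dom h)).unique h h'

end SetTheory

/-! ### Order types, indices in sets of ordinals, and regularity. -/

section OrderTypes

variable {M : Type u} [setLanguage.Structure M] [ZFModel M]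

/-! ### Order types -/

/-- `f` is an increasing function from the ordinal `τ` onto `X`. -/
def IsEnum (f : M) (X : Set M) (τ : M) : Prop :=
  IsFunInto f (elts τ) X ∧ (∀ x, x ∈ X → ∃ ξ, Maps f ξ x) ∧
    ∀ ξ ζ x y, Maps f ξ x → Maps f ζ y → ξ ∈ₘ ζ → x ∈ₘ y

theorem IsEnum.lt_of_lt {f τ ξ ζ x y : M} {X : Set M} (hτ : IsOrd τ) (hf : IsEnum f X τ)
    (hx : Maps f ξ x) (hy : Maps f ζ y) (h : x ∈ₘ y) : ξ ∈ₘ ζ := by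
  rcases (hτ.mem (hf.1.1.mem_dom hx)).trichotomy (hτ.mem (hf.1.1.mem_dom hy)) with h' | rfl | h'
  · exact h'
  · exact (mem_irrefl x (hf.1.1.unique hy hx ▸ h)).elim
  · exact (mem_asymm h (hf.2.2 _ _ _ _ hy hx h')).elim

theorem IsEnum.restrict {f τ ξ x : M} {X : Set M} (hτ : IsOrd τ) (hf : IsEnum f X τ)
    (hx : Maps f ξ x) : HasOrderType {y | y ∈ X ∧ y ∈ₘ x} ξ := by
  have hξ : ξ ∈ₘ τ := hf.1.1.mem_dom hx
  obtain ⟨g, hg, hgm⟩ := exists_graph ξ (fun ζ y => Maps f ζ y)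
    fun ζ hζ => hf.1.1.2 ζ (hτ.trans hζ hξ)
  refine ⟨hτ.mem hξ, g, ⟨hg, fun ζ y h => ?_⟩, fun y hy => ?_, fun ζ ζ' y y' h h' => ?_⟩
  · obtain ⟨hζ, h⟩ := (hgm _ _).1 h
    exact ⟨hf.1.2 _ _ h, hf.2.2 _ _ _ _ h hx hζ⟩
  · obtain ⟨ζ, hζ⟩ := hf.2.1 y hy.1
    exact ⟨ζ, (hgm _ _).2 ⟨hf.lt_of_lt hτ hζ hx hy.2, hζ⟩⟩
  · exact hf.2.2 _ _ _ _ ((hgm _ _).1 h).2 ((hgm _ _).1 h').2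

theorem HasOrderType.exists_lt {X : Set M} {τ ξ : M} (h : HasOrderType X τ) (hξ : ξ ∈ₘ τ) :
    ∃ x, x ∈ X ∧ HasOrderType {y | y ∈ X ∧ y ∈ₘ x} ξ := by
  obtain ⟨hτ, f, hf⟩ := h
  obtain ⟨x, hx, -⟩ := hf.1.1.2 ξ hξ
  exact ⟨x, hf.1.2 _ _ hx, IsEnum.restrict hτ hf hx⟩

theorem HasOrderType.exists_of_mem {X : Set M} {τ x : M} (h : HasOrderType X τ) (hx : x ∈ X) :
    ∃ ξ, ξ ∈ₘ τ ∧ HasOrderType {y | y ∈ X ∧ y ∈ₘ x} ξ := by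
  obtain ⟨hτ, f, hf⟩ := h
  obtain ⟨ξ, hξ⟩ := hf.2.1 x hx
  exact ⟨ξ, hf.1.1.mem_dom hξ, IsEnum.restrict hτ hf hξ⟩

/-- At the least disagreement `μ`, write `f μ = g ζ`. If `μ < ζ`, then `g μ` is some `f ν` with `ν <
μ`, where `f` and `g` agree, so `g` repeats a value; `ζ < μ` makes `f` repeat one. -/
theorem IsEnum.agree {f g τ τ' ξ : M} {X : Set M} (hτ : IsOrd τ) (hτ' : IsOrd τ')
    (hf : IsEnum f X τ) (hg : IsEnum g X τ') (hξ : ξ ∈ₘ τ) : ∃ x, Maps f ξ x ∧ Maps g ξ x := by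
  by_contra hne
  obtain ⟨μ, hμ, hPμ, hle, hmin⟩ := (hτ.mem hξ).exists_least
    (fun ζ => ¬ ∃ x, Maps f ζ x ∧ Maps g ζ x) hne
  have hμτ := hle.trans_mem hξ hτ
  obtain ⟨x, hx, -⟩ := hf.1.1.2 μ hμτ
  obtain ⟨ζ, hζ⟩ := hg.2.1 x (hf.1.2 _ _ hx)
  have hζτ : ζ ∈ₘ τ' := hg.1.1.mem_dom hζ
  rcases hμ.trichotomy (hτ'.mem hζτ) with h | rfl | h
  · obtain ⟨y, hy, -⟩ := hg.1.1.2 μ (hτ'.trans h hζτ)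
    have hyx := hg.2.2 _ _ _ _ hy hζ h
    obtain ⟨ν, hν⟩ := hf.2.1 y (hg.1.2 _ _ hy)
    have hνμ := hf.lt_of_lt hτ hν hx hyx
    obtain ⟨z, hz, hz'⟩ := not_not.1 (hmin ν hνμ)
    obtain rfl := hf.1.1.unique hz hν
    exact mem_irrefl _ (hg.2.2 _ _ _ _ hz' hy hνμ)
  · exact hPμ ⟨x, hx, hζ⟩
  · obtain ⟨z, hz, hz'⟩ := not_not.1 (hmin ζ h)
    obtain rfl := hg.1.1.unique hz' hζ
    exact mem_irrefl _ (hf.2.2 _ _ _ _ hz hx h)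

theorem HasOrderType.unique {X : Set M} {τ τ' : M} (h : HasOrderType X τ)
    (h' : HasOrderType X τ') : τ = τ' := by
  obtain ⟨hτ, f, hf⟩ := h
  obtain ⟨hτ', g, hg⟩ := h'
  refine ZFModel.extensionality _ _ fun ξ => ⟨fun hξ => ?_, fun hξ => ?_⟩
  · obtain ⟨x, -, hx⟩ := IsEnum.agree hτ hτ' hf hg hξ
    exact hg.1.1.mem_dom hx
  · obtain ⟨x, -, hx⟩ := IsEnum.agree hτ' hτ hg hf hξ
    exact hf.1.1.mem_dom hx

/-! ### Enumerating sets of ordinals -/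

theorem IsNth.unique_index {c η η' x : M} (h : IsNth c η x) (h' : IsNth c η' x) : η = η' :=
  h.2.unique h'.2

theorem IsNth.lt {c η η' x x' : M} (hx' : IsOrd x') (h : IsNth c η x) (h' : IsNth c η' x')
    (hlt : x ∈ₘ x') : η ∈ₘ η' := by
  obtain ⟨ξ, hξ, hot⟩ := h'.2.exists_of_mem ⟨h.1, hlt⟩
  have : {y | y ∈ {y | y ∈ₘ c ∧ y ∈ₘ x'} ∧ y ∈ₘ x} = {y | y ∈ₘ c ∧ y ∈ₘ x} :=
    Set.ext fun y => ⟨fun hy => ⟨hy.1.1, hy.2⟩, fun hy => ⟨⟨hy.1, hx'.trans hy.2 hlt⟩, hy.2⟩⟩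
  rw [this] at hot
  exact h.2.unique hot ▸ hξ

theorem IsNth.unique {c η x x' : M} (hx : IsOrd x) (hx' : IsOrd x') (h : IsNth c η x)
    (h' : IsNth c η x') : x = x' :=
  hx.eq_of_not_mem hx' (fun hlt => mem_irrefl _ (h.lt hx' h' hlt))
    fun hlt => mem_irrefl _ (h'.lt hx h hlt)

theorem IsNth.lt_of_lt {c η η' x x' : M} (hx : IsOrd x) (hx' : IsOrd x') (h : IsNth c η x)
    (h' : IsNth c η' x') (hlt : η ∈ₘ η') : x ∈ₘ x' := by
  rcases hx.trichotomy hx' with h0 | rfl | h0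
  · exact h0
  · exact (mem_irrefl _ (h.unique_index h' ▸ hlt)).elim
  · exact (mem_asymm hlt (h'.lt hx h h0)).elim

/-- The `ζ`-th member of `c` exists whenever a later one does. -/
theorem IsNth.exists_of_lt {c η ζ x : M} (hx : IsOrd x) (h : IsNth c η x) (hζ : ζ ∈ₘ η) :
    ∃ y, y ∈ₘ x ∧ IsNth c ζ y := by
  obtain ⟨y, hy, hot⟩ := h.2.exists_lt hζ
  have : {z | z ∈ {y | y ∈ₘ c ∧ y ∈ₘ x} ∧ z ∈ₘ y} = {z | z ∈ₘ c ∧ z ∈ₘ y} :=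
    Set.ext fun z => ⟨fun hz => ⟨hz.1.1, hz.2⟩, fun hz => ⟨⟨hz.1, hx.trans hz.2 hy.2⟩, hz.2⟩⟩
  rw [this] at hot
  exact ⟨y, hy.2, hy.1, hot⟩

/-- The order type is the set of all indices, which is transitive because earlier members exist
whenever later ones do. -/
theorem exists_orderType_of_isNth {c : M} (hc : ∀ x, x ∈ₘ c → IsOrd x)
    (h : ∀ x, x ∈ₘ c → ∃ η, IsNth c η x) :
    ∃ τ, HasOrderType (elts c) τ ∧ ∀ η, η ∈ₘ τ ↔ ∃ x, IsNth c η x := by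
  obtain ⟨τ, hτ⟩ := exists_replacement (fun x η => IsNth c η x) c fun x hx => by
    obtain ⟨η, hη⟩ := h x hx
    exact ⟨η, hη, fun _ h' => h'.unique_index hη⟩
  have hmem : ∀ η, η ∈ₘ τ ↔ ∃ x, IsNth c η x := fun η =>
    (hτ η).trans ⟨fun ⟨x, _, h⟩ => ⟨x, h⟩, fun ⟨x, h⟩ => ⟨x, h.1, h⟩⟩
  have htr : ∀ η, η ∈ₘ τ → ∀ ζ, ζ ∈ₘ η → ζ ∈ₘ τ := by
    intro η hη ζ hζ
    obtain ⟨x, hx⟩ := (hmem η).1 hη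
    obtain ⟨y, -, hy⟩ := hx.exists_of_lt (hc x hx.1) hζ
    exact (hmem ζ).2 ⟨y, hy⟩
  have hord : IsOrd τ := ⟨htr, fun η hη => by
    obtain ⟨x, hx⟩ := (hmem η).1 hη
    exact hx.2.1.1⟩
  obtain ⟨f, hf, hfm⟩ := exists_graph τ (fun η x => IsNth c η x) fun η hη => by
    obtain ⟨x, hx⟩ := (hmem η).1 hη
    exact ⟨x, hx, fun y hy => hy.unique (hc y hy.1) (hc x hx.1) hx⟩
  refine ⟨τ, ⟨hord, f, ⟨hf, fun η x h => ((hfm η x).1 h).2.1⟩, fun x hx => ?_, ?_⟩, hmem⟩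
  · obtain ⟨η, hη⟩ := h x hx
    exact ⟨η, (hfm η x).2 ⟨(hmem η).2 ⟨x, hη⟩, hη⟩⟩
  · intro η ζ x y hx hy
    have hx := ((hfm _ _).1 hx).2
    have hy := ((hfm _ _).1 hy).2
    exact hx.lt_of_lt (hc x hx.1) (hc y hy.1) hy

/-- Below a minimal member without index every member has one, so that initial segment has an order
type, which is the missing index. -/
theorem exists_isNth {c x : M} (hc : ∀ x, x ∈ₘ c → IsOrd x) (hx : x ∈ₘ c) : ∃ η, IsNth c η x := by
  by_contra hne
  obtain ⟨m, hm, hPm, hmin⟩ := exists_minimal (fun x => ¬ ∃ η, IsNth c η x) hx hne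
  obtain ⟨d, hd⟩ := exists_sep (fun y => y ∈ₘ m) c
  have key : ∀ y η, y ∈ₘ d → (IsNth d η y ↔ IsNth c η y) := by
    intro y η hy
    have : {z | z ∈ₘ d ∧ z ∈ₘ y} = {z | z ∈ₘ c ∧ z ∈ₘ y} := Set.ext fun z =>
      ⟨fun hz => ⟨((hd z).1 hz.1).1, hz.2⟩,
        fun hz => ⟨(hd z).2 ⟨hz.1, (hc m hm).trans hz.2 ((hd y).1 hy).2⟩, hz.2⟩⟩
    rw [IsNth, IsNth, this]
    exact and_congr_left fun _ => ⟨fun h => ((hd y).1 h).1, fun _ => hy⟩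
  obtain ⟨τ, hτ, -⟩ := exists_orderType_of_isNth (c := d) (fun y hy => hc y ((hd y).1 hy).1)
    fun y hy => by
      obtain ⟨η, hη⟩ := not_not.1 fun h => hmin y ((hd y).1 hy).1 h ((hd y).1 hy).2
      exact ⟨η, (key y η hy).2 hη⟩
  refine hPm ⟨τ, hm, ?_⟩
  have : elts d = {y | y ∈ₘ c ∧ y ∈ₘ m} := Set.ext hd
  exact this ▸ hτ

/-! ### Regularity -/

/-- Collection below `lam` without choice: the map from `ξ` to its least witness has domain `a <
lam`, so it is not cofinal. -/
theorem IsRegularUncountable.exists_bound {lam a : M} (hlam : IsRegularUncountable lam)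
    (ha : a ∈ₘ lam) (P : M → M → Prop) [Def M fun p : M × M => P p.1 p.2]
    (h : ∀ ξ, ξ ∈ₘ a → ∃ y, y ∈ₘ lam ∧ P ξ y) :
    ∃ β, β ∈ₘ lam ∧ ∀ ξ, ξ ∈ₘ a → ∃ y, y ∈ₘ β ∧ P ξ y := by
  obtain ⟨hord, -, hcof⟩ := hlam
  have inst : ∀ {α : Type u} [Ctx M α] (t s : α → M) [DefTerm M t] [DefTerm M s],
      Def M fun a => P (t a) (s a) := fun t s => Def.comp₂ P t s
  obtain ⟨f, hf, hfm⟩ := exists_graph a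
    (fun ξ y => y ∈ₘ lam ∧ P ξ y ∧ ∀ z, z ∈ₘ y → ¬ P ξ z) fun ξ hξ => by
      obtain ⟨y, hy, hP⟩ := h ξ hξ
      obtain ⟨m, hm, hPm, hle, hmin⟩ := (hord.mem hy).exists_least (fun z => P ξ z) hP
      refine ⟨m, ⟨hle.trans_mem hy hord, hPm, hmin⟩, ?_⟩
      rintro n ⟨hn, hPn, hnmin⟩
      exact (hord.mem hn).eq_of_not_mem hm (fun h => hmin _ h hPn) fun h => hnmin _ h hPm
  by_contra hne
  refine hcof.2.2.2 a ha ⟨f, ⟨hf, fun ξ y h => ((hfm _ _).1 h).2.1⟩, fun β hβ => ?_⟩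
  by_contra hβ'
  refine hne ⟨β, hβ, fun ξ hξ => ?_⟩
  obtain ⟨y, hy, -⟩ := hf.2 ξ hξ
  have hy' := (hfm _ _).1 hy
  exact ⟨y, ((hord.mem hy'.2.1).mem_or_le (hord.mem hβ)).resolve_right
    fun hle => hβ' ⟨ξ, y, hy, hle⟩, hy'.2.2.1⟩

/-- An unbounded subset of a regular cardinal `lam` has order type at least `lam`. -/
theorem IsRegularUncountable.exists_isNth {lam c η : M} (hlam : IsRegularUncountable lam)
    (hc : ∀ x, x ∈ₘ c → x ∈ₘ lam) (hub : ∀ x, x ∈ₘ lam → ∃ y, y ∈ₘ c ∧ Le x y)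
    (hη : η ∈ₘ lam) : ∃ x, IsNth c η x := by
  have hc' : ∀ x, x ∈ₘ c → IsOrd x := fun x hx => hlam.1.mem (hc x hx)
  obtain ⟨τ, ⟨hτ, f, hf⟩, hmem⟩ :=
    exists_orderType_of_isNth hc' fun x hx => ZFInternal.exists_isNth hc' hx
  refine (hmem η).1 ?_
  rcases hτ.trichotomy hlam.1 with h | rfl | h
  · refine (hlam.2.2.2.2.2 τ h ⟨f, ⟨hf.1.1, fun ξ y h => hc y (hf.1.2 _ _ h)⟩, fun x hx => ?_⟩).elim
    obtain ⟨y, hy, hxy⟩ := hub x hx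
    obtain ⟨ξ, hξ⟩ := hf.2.1 y hy
    exact ⟨ξ, y, hξ, hxy⟩
  · exact hη
  · exact hτ.trans hη h

end OrderTypes

/-! ### Suprema of iterations and clubs of closure points. -/

section Closure

variable {M : Type u} [setLanguage.Structure M] [ZFModel M]

/-! ### Closure points -/

/-- A constant family indexed by `ω` is bounded, by regularity and `ω < lam`. -/
theorem IsRegularUncountable.exists_gt {lam x : M} (hlam : IsRegularUncountable lam)
    (hx : x ∈ₘ lam) : ∃ y, y ∈ₘ lam ∧ x ∈ₘ y := by
  obtain ⟨w, hw, hwl⟩ := hlam.2.1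
  obtain ⟨β, hβ, h⟩ := hlam.exists_bound hwl (fun _ y => x = y) fun _ _ => ⟨x, hx, rfl⟩
  obtain ⟨n, hn⟩ := hw.1.2.1
  obtain ⟨_, hy, rfl⟩ := h n hn
  exact ⟨β, hβ, hy⟩

theorem IsRegularUncountable.succ_mem {lam x s : M} (hlam : IsRegularUncountable lam)
    (hx : x ∈ₘ lam) (hs : IsSucc s x) : s ∈ₘ lam := by
  obtain ⟨y, hy, hxy⟩ := hlam.exists_gt hx
  have hyo := hlam.1.mem hy
  refine Le.trans_mem ((hyo.mem_or_le (hs.isOrd (hyo.mem hxy))).resolve_left fun h => ?_) hy hlam.1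
  rcases (hs y).1 h with h | rfl
  · exact mem_asymm h hxy
  · exact mem_irrefl _ hxy

theorem IsRegularUncountable.exists_bound_le {lam a : M} (hlam : IsRegularUncountable lam)
    (ha : a ∈ₘ lam) (P : M → M → Prop) [Def M fun p : M × M => P p.1 p.2]
    (h : ∀ ξ, ξ ∈ₘ lam → ∃ y, y ∈ₘ lam ∧ P ξ y) :
    ∃ β, β ∈ₘ lam ∧ a ∈ₘ β ∧ ∀ ξ, Le ξ a → ∃ y, y ∈ₘ β ∧ P ξ y := by
  obtain ⟨s, hs⟩ := exists_succ a
  have hsl := hlam.succ_mem ha hs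
  obtain ⟨β, hβ, hβP⟩ := hlam.exists_bound hsl P fun ξ hξ => h ξ (hlam.1.trans hξ hsl)
  have hP : ∀ ξ, Le ξ a → ∃ y, y ∈ₘ β ∧ P ξ y := fun ξ hξ => hβP ξ ((hs ξ).2 hξ)
  rcases (hlam.1.mem ha).mem_or_le (hlam.1.mem hβ) with hlt | hle
  · exact ⟨β, hβ, hlt, hP⟩
  · refine ⟨s, hsl, (hs a).2 (.inr rfl), fun ξ hξ => ?_⟩
    obtain ⟨y, hy, hPy⟩ := hP ξ hξ
    exact ⟨y, (hs y).2 (.inl (mem_of_mem_of_le hy hle (hlam.1.mem ha))), hPy⟩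

/-- The iterates of a monotone, inflationary function `S` starting from `x₀` have a supremum
below the regular uncountable cardinal `lam`. -/
theorem IsRegularUncountable.exists_sup_iterates {lam x₀ : M} (hlam : IsRegularUncountable lam)
    (S : M → M → Prop) [Def M fun p : M × M => S p.1 p.2]
    (htot : ∀ x, x ∈ₘ lam → ∃ h, S x h) (hran : ∀ x h, S x h → h ∈ₘ lam ∧ x ∈ₘ h)
    (hmono : ∀ u v h k, S u h → S v k → Le u v → Le h k) (hx₀ : x₀ ∈ₘ lam) :
    ∃ w, w ∈ₘ lam ∧ x₀ ∈ₘ w ∧ IsLimit w ∧ ∀ x, x ∈ₘ w → ∃ t h, Le x t ∧ S t h ∧ h ∈ₘ w := by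
  have inst : ∀ {α : Type u} [Ctx M α] (t s : α → M) [DefTerm M t] [DefTerm M s],
      Def M fun a => S (t a) (s a) := fun t s => Def.comp₂ S t s
  -- The orbit of `x₀` is defined as the intersection of all sets containing `x₀` and closed under
  -- `S`, which avoids recursion on `ω`.
  obtain ⟨T, hT⟩ := exists_sep
    (fun t => ∀ X, x₀ ∈ₘ X → (∀ u h, u ∈ₘ X → S u h → h ∈ₘ X) → t ∈ₘ X) lam
  have hTl : ∀ t, t ∈ₘ T → t ∈ₘ lam := fun t ht => ((hT t).1 ht).1
  have hTo : ∀ t, t ∈ₘ T → IsOrd t := fun t ht => hlam.1.mem (hTl t ht)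
  have hTmin : ∀ {t X}, t ∈ₘ T → x₀ ∈ₘ X → (∀ u h, u ∈ₘ X → S u h → h ∈ₘ X) → t ∈ₘ X :=
    fun ht => ((hT _).1 ht).2 _
  have hx₀T : x₀ ∈ₘ T := (hT _).2 ⟨hx₀, fun _ h _ => h⟩
  have hTcl : ∀ u h, u ∈ₘ T → S u h → h ∈ₘ T := fun u h hu hS =>
    (hT _).2 ⟨(hran _ _ hS).1, fun X h0 hX => hX u h (hTmin hu h0 hX) hS⟩
  have hind : ∀ (Q : M → Prop) [Def M Q], Q x₀ → (∀ u h, u ∈ₘ T → Q u → S u h → Q h) →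
      ∀ t, t ∈ₘ T → Q t := by
    intro Q _ h0 hs t ht
    obtain ⟨X, hX⟩ := exists_sep Q T
    exact ((hX t).1 (hTmin ht ((hX _).2 ⟨hx₀T, h0⟩) fun u h hu hS =>
      (hX _).2 ⟨hTcl u h ((hX _).1 hu).1 hS, hs u h ((hX _).1 hu).1 ((hX _).1 hu).2 hS⟩)).2
  have hge : ∀ t, t ∈ₘ T → Le x₀ t := hind (fun t => Le x₀ t) (.inr rfl) fun u h hu hle hS =>
    .inl (hle.trans_mem (hran _ _ hS).2 (hTo _ (hTcl _ _ hu hS)))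
  have hstep : ∀ {h v k}, v ∈ₘ T → S v k → Le h v → Le h k := fun hv hS hle =>
    .inl (hle.trans_mem (hran _ _ hS).2 (hTo _ (hTcl _ _ hv hS)))
  -- No member of the orbit lies strictly between `u` and its image; double induction along the
  -- orbit, using monotonicity.
  have hgap : ∀ u, u ∈ₘ T → ∀ v, v ∈ₘ T → Le v u ∨ ∃ h, S u h ∧ Le h v := by
    refine hind (fun u => ∀ v, v ∈ₘ T → Le v u ∨ ∃ h, S u h ∧ Le h v) ?_ ?_
    · refine hind (fun v => Le v x₀ ∨ ∃ h, S x₀ h ∧ Le h v) (.inl (.inr rfl)) ?_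
      rintro v k hv (hle | ⟨h, hS, hle⟩) hk
      · obtain rfl := hle.antisymm (hge v hv)
        exact .inr ⟨k, hk, .inr rfl⟩
      · exact .inr ⟨h, hS, hstep hv hk hle⟩
    · intro u h hu hC hSh
      refine hind (fun v => Le v h ∨ ∃ k, S h k ∧ Le k v) (.inl (hge h (hTcl _ _ hu hSh))) ?_
      rintro v k hv (hle | ⟨l, hS, hle⟩) hk
      · rcases hC v hv with hvu | ⟨h', hS', hle'⟩
        · exact .inl (hmono _ _ _ _ hk hSh hvu)
        · obtain rfl := (hmono _ _ _ _ hS' hSh (.inr rfl)).antisymm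
            (hmono _ _ _ _ hSh hS' (.inr rfl))
          obtain rfl := hle.antisymm hle'
          exact .inr ⟨k, hk, .inr rfl⟩
      · exact .inr ⟨l, hS, hstep hv hk hle⟩
  by_cases hb : ∃ b, b ∈ₘ lam ∧ ∀ t, t ∈ₘ T → t ∈ₘ b
  -- The least strict upper bound of the orbit is the required supremum.
  · obtain ⟨b, hb, hTb⟩ := hb
    obtain ⟨w, hw, hTw, hle, hmin⟩ := (hlam.1.mem hb).exists_least
      (fun w => ∀ t, t ∈ₘ T → t ∈ₘ w) hTb
    have key : ∀ x, x ∈ₘ w → ∃ t h, Le x t ∧ S t h ∧ h ∈ₘ w := by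
      intro x hx
      obtain ⟨t, ht, htx⟩ : ∃ t, t ∈ₘ T ∧ ¬ t ∈ₘ x := by simpa using hmin x hx
      obtain ⟨h, hS⟩ := htot t (hTl t ht)
      exact ⟨t, h, (hTo t ht).le_of_not_mem (hw.mem hx) htx, hS, hTw h (hTcl _ _ ht hS)⟩
    refine ⟨w, hle.trans_mem hb hlam.1, hTw _ hx₀T, ⟨hw, ⟨_, hTw _ hx₀T⟩, fun x hx => ?_⟩, key⟩
    obtain ⟨t, h, hxt, hS, hh⟩ := key x hx
    exact ⟨h, hh, hxt.trans_mem (hran _ _ hS).2 (hw.mem hh)⟩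
  -- An unbounded orbit would have an `ω`-th member `t`. Its members below `t` include `x₀` and, by
  -- `hgap`, are closed under `S`, so they are the whole orbit and `t ∈ t`.
  · exfalso
    obtain ⟨w, hw, hwl⟩ := hlam.2.1
    obtain ⟨t, ht⟩ := hlam.exists_isNth hTl (fun x hx => by
      by_contra hne
      exact hb ⟨x, hx, fun t ht => ((hTo t ht).mem_or_le (hlam.1.mem hx)).resolve_right
        fun hle => hne ⟨t, ht, hle⟩⟩) hwl
    have hto := hTo t ht.1
    obtain ⟨X, hX⟩ := exists_sep (fun y => y ∈ₘ t) T
    refine mem_irrefl t ((hX t).1 (hTmin ht.1 ((hX _).2 ⟨hx₀T, ?_⟩) fun u h hu hS =>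
      (hX _).2 ⟨hTcl u h ((hX _).1 hu).1 hS, ?_⟩)).2
    · obtain ⟨n, hn⟩ := hw.1.2.1
      obtain ⟨y, hyt, hy⟩ := ht.exists_of_lt hto hn
      exact (hge y hy.1).trans_mem hyt hto
    · obtain ⟨huT, hut⟩ := (hX _).1 hu
      obtain ⟨ζ, hζ⟩ := ZFInternal.exists_isNth hTo huT
      obtain ⟨ζ', hζ', hlt⟩ := hw.1.2.2 ζ (hζ.lt hto ht hut)
      obtain ⟨v, hvt, hv⟩ := ht.exists_of_lt hto hζ'
      have huv := hζ.lt_of_lt (hTo u huT) (hTo v hv.1) hv hlt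
      rcases hgap u huT v hv.1 with hle | ⟨h', hS', hle⟩
      · exact (hle.not_mem huv).elim
      · exact (hmono _ _ _ _ hS hS' (.inr rfl)).trans_mem (hle.trans_mem hvt hto) hto

/-- For a total relation `R` on a regular uncountable cardinal, the limit ordinals closed under `R`
form a club. -/
theorem IsRegularUncountable.exists_club_closed {lam : M} (hlam : IsRegularUncountable lam)
    (R : M → M → Prop) [Def M fun p : M × M => R p.1 p.2]
    (hR : ∀ x, x ∈ₘ lam → ∃ β, β ∈ₘ lam ∧ R x β) :
    ∃ D, IsClubIn lam D ∧ ∀ y, y ∈ₘ D → IsLimit y ∧ ∀ x, x ∈ₘ y → ∃ β, β ∈ₘ y ∧ R x β := by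
  have inst : ∀ {α : Type u} [Ctx M α] (t s : α → M) [DefTerm M t] [DefTerm M s],
      Def M fun a => R (t a) (s a) := fun t s => Def.comp₂ R t s
  obtain ⟨D, hD⟩ := exists_sep (fun y => IsLimit y ∧ ∀ x, x ∈ₘ y → ∃ β, β ∈ₘ y ∧ R x β) lam
  refine ⟨D, ⟨fun x hx => ((hD x).1 hx).1, fun x₀ hx₀ => ?_, fun δ hδ hlim hub => ?_⟩,
    fun y hy => ((hD y).1 hy).2⟩
  -- Iterate the least `h > x` below which every `y ≤ x` has an `R`-witness. Asking this for all `y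
  -- ≤ x`, not just for `x`, makes the map monotone.
  · obtain ⟨w, hwl, hxw, hw, hcl⟩ := hlam.exists_sup_iterates
      (fun x h => h ∈ₘ lam ∧ (x ∈ₘ h ∧ ∀ y, Le y x → ∃ β, β ∈ₘ h ∧ R y β) ∧
        ∀ k, k ∈ₘ h → ¬ (x ∈ₘ k ∧ ∀ y, Le y x → ∃ β, β ∈ₘ k ∧ R y β))
      (fun x hx => by
        obtain ⟨β, hβ, hxβ, hβR⟩ := hlam.exists_bound_le hx R hR
        obtain ⟨m, hm, hPm, hle, hmin⟩ := (hlam.1.mem hβ).exists_least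
          (fun h => x ∈ₘ h ∧ ∀ y, Le y x → ∃ β, β ∈ₘ h ∧ R y β) ⟨hxβ, hβR⟩
        exact ⟨m, hle.trans_mem hβ hlam.1, hPm, hmin⟩)
      (fun x h hS => ⟨hS.1, hS.2.1.1⟩)
      (fun u v h k hu hv huv => (hlam.1.mem hv.1).le_of_not_mem (hlam.1.mem hu.1) fun hkh =>
        hu.2.2 k hkh ⟨huv.trans_mem hv.2.1.1 (hlam.1.mem hv.1), fun y hy =>
          hv.2.1.2 y (hy.trans huv ((hlam.1.mem hv.1).mem hv.2.1.1))⟩) hx₀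
    refine ⟨w, (hD w).2 ⟨hwl, hw, fun x hx => ?_⟩, hxw⟩
    obtain ⟨t, h, hxt, hS, hh⟩ := hcl x hx
    obtain ⟨β, hβ, hRβ⟩ := hS.2.1.2 x hxt
    exact ⟨β, hw.1.trans hβ hh, hRβ⟩
  · refine (hD δ).2 ⟨hδ, hlim, fun x hx => ?_⟩
    obtain ⟨y, hy, hxy, hyδ⟩ := hub x hx
    obtain ⟨β, hβ, hRβ⟩ := ((hD y).1 hy).2.2 x hxy
    exact ⟨β, hlim.1.trans hβ hyδ, hRβ⟩

end Closure

/-! ### Clubs, coding of pairs, and the two regressive functions. -/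

section Ladders

/-! ### Clubs, stationary sets, regressive functions -/

variable {M : Type u} [setLanguage.Structure M]

theorem IsStationaryIn.mono {lam : M} {A B : Set M} (h : IsStationaryIn lam A) (hAB : A ⊆ B)
    (hB : B ⊆ elts lam) : IsStationaryIn lam B :=
  ⟨hB, fun D hD => (h.2 D hD).imp fun _ hδ => ⟨hδ.1, hAB hδ.2⟩⟩

theorem exists_club_disjoint {lam : M} {A : Set M} (hA : A ⊆ elts lam)
    (h : ¬ IsStationaryIn lam A) : ∃ D, IsClubIn lam D ∧ ∀ δ, δ ∈ₘ D → δ ∉ A := by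
  by_contra hne
  push Not at hne
  exact h ⟨hA, hne⟩

variable [ZFModel M]

/-- The increasing enumeration of a club is continuous. -/
theorem IsClubIn.exists_enumeration {lam E : M} (hlam : IsRegularUncountable lam)
    (hE : IsClubIn lam E) :
    ∃ s, IsContinuousIncreasing lam s ∧ ∀ ξ x, Maps s ξ x → x ∈ₘ E := by
  have hEo : ∀ x, x ∈ₘ E → IsOrd x := fun x hx => hlam.1.mem (hE.1 x hx)
  obtain ⟨s, hs, hsm⟩ := exists_graph lam (fun ξ x => IsNth E ξ x) fun ξ hξ => by
    obtain ⟨x, hx⟩ := hlam.exists_isNth hE.1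
      (fun x hx => (hE.2.1 x hx).imp fun y hy => ⟨hy.1, .inl hy.2⟩) hξ
    exact ⟨x, hx, fun y hy => hy.unique (hEo y hy.1) (hEo x hx.1) hx⟩
  have hsE : ∀ {ξ x}, Maps s ξ x → x ∈ₘ E := fun h => ((hsm _ _).1 h).2.1
  have hinc : ∀ ξ ζ x y, Maps s ξ x → Maps s ζ y → ξ ∈ₘ ζ → x ∈ₘ y := fun ξ ζ x y hx hy h =>
    ((hsm _ _).1 hx).2.lt_of_lt (hEo x (hsE hx)) (hEo y (hsE hy)) ((hsm _ _).1 hy).2 h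
  refine ⟨s, ⟨⟨hs, fun ξ x h => hE.1 x (hsE h)⟩, hinc, fun ξ y hξ hy z => ⟨fun hz => ?_, ?_⟩⟩,
    fun ξ x h => hsE h⟩
  · by_contra hne
    have hξl : ξ ∈ₘ lam := hs.mem_dom hy
    have hyo := hEo y (hsE hy)
    -- `w` is the supremum of the earlier values. If it were below `s ξ`, it would be a member of
    -- `E` with index below `ξ`, hence below itself.
    obtain ⟨w, hw, hwub, hwz, hmin⟩ := (hyo.mem hz).exists_least
      (fun w => ∀ ζ u, ζ ∈ₘ ξ → Maps s ζ u → ¬ w ∈ₘ u)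
      fun ζ u hζ hu hzu => hne ⟨ζ, u, hζ, hu, hzu⟩
    have hwy : w ∈ₘ y := hwz.trans_mem hz hyo
    have hbelow : ∀ ζ u, ζ ∈ₘ ξ → Maps s ζ u → u ∈ₘ w := by
      intro ζ u hζ hu
      obtain ⟨ζ', hζ', hlt⟩ := hξ.2.2 ζ hζ
      obtain ⟨u', hu', -⟩ := hs.2 ζ' (hlam.1.trans hζ' hξl)
      exact mem_of_mem_of_le (hinc _ _ _ _ hu hu' hlt)
        (hw.le_of_not_mem (hEo _ (hsE hu')) (hwub ζ' u' hζ' hu')) hw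
    have hcof : ∀ x, x ∈ₘ w → ∃ u, u ∈ₘ E ∧ x ∈ₘ u ∧ u ∈ₘ w := by
      intro x hx
      have := hmin x hx
      push Not at this
      obtain ⟨ζ, u, hζ, hu, hxu⟩ := this
      exact ⟨u, hsE hu, hxu, hbelow ζ u hζ hu⟩
    have hwlim : IsLimit w := by
      refine ⟨hw, ?_, fun x hx => (hcof x hx).imp fun u hu => ⟨hu.2.2, hu.2.1⟩⟩
      obtain ⟨ζ, hζ⟩ := hξ.2.1
      obtain ⟨u, hu, -⟩ := hs.2 ζ (hlam.1.trans hζ hξl)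
      exact ⟨u, hbelow ζ u hζ hu⟩
    have hwE := hE.2.2 w (hlam.1.trans hwy (hE.1 y (hsE hy))) hwlim hcof
    obtain ⟨ν, hν⟩ := exists_isNth hEo hwE
    have hνξ := hν.lt hyo ((hsm _ _).1 hy).2 hwy
    exact mem_irrefl w (hbelow ν w hνξ ((hsm _ _).2 ⟨hlam.1.trans hνξ hξl, hν⟩))
  · rintro ⟨ζ, u, hζ, hu, hzu⟩
    exact (hEo y (hsE hy)).trans hzu (hinc _ _ _ _ hu hy hζ)

/-- With choice for `γ`-sequences, `γ` many classes are simultaneously avoided by a club if each of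
them is. -/
theorem exists_club_disjoint_of_ac {lam γ : M} (hlam : IsRegularUncountable lam)
    (hγ : γ ∈ₘ lam) (hac : ACFor γ) (A : M → Set M) [hA : DefSet M A]
    (h : ∀ η, η ∈ₘ γ → ∃ D, IsClubIn lam D ∧ ∀ δ, δ ∈ₘ D → δ ∉ A η) :
    ∃ D, IsClubIn lam D ∧ ∀ δ, δ ∈ₘ D → ∀ η, η ∈ₘ γ → δ ∉ A η := by
  have inst : ∀ {α : Type u} [Ctx M α] (t : α → M) [DefTerm M t], DefSet M fun a => A (t a) :=
    fun t => DefSet.comp A t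
  obtain ⟨Pw, hPw⟩ := ZFModel.power lam
  obtain ⟨X, hX, hXm⟩ := exists_graph γ
    (fun η x => ∀ D, D ∈ₘ x ↔ D ∈ₘ Pw ∧ IsClubIn lam D ∧ ∀ δ, δ ∈ₘ D → δ ∉ A η) fun η _ => by
      obtain ⟨x, hx⟩ := exists_sep (fun D => IsClubIn lam D ∧ ∀ δ, δ ∈ₘ D → δ ∉ A η) Pw
      exact ⟨x, hx, fun y hy => ZFModel.extensionality _ _ fun D => (hy D).trans (hx D).symm⟩
  obtain ⟨f, hf, hfX⟩ := hac X hX fun η x hx => by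
    obtain ⟨hη, hx⟩ := (hXm _ _).1 hx
    obtain ⟨D, hD, hDA⟩ := h η hη
    exact ⟨D, (hx D).2 ⟨(hPw D).2 hD.1, hD, hDA⟩⟩
  have hfD : ∀ η D, Maps f η D → IsClubIn lam D ∧ ∀ δ, δ ∈ₘ D → δ ∉ A η := by
    intro η D hD
    obtain ⟨x, hx, -⟩ := hX.2 η (hf.mem_dom hD)
    exact ((((hXm _ _).1 hx).2 D).1 (hfX η x D hx hD)).2
  -- A closure point is a limit of every chosen club, so this club lies in their intersection.
  obtain ⟨D, hD, hDcl⟩ := hlam.exists_club_closed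
    (fun x y => ∀ η, η ∈ₘ γ → ∃ z, z ∈ₘ y ∧ ∀ C, Maps f η C → z ∈ₘ C ∧ x ∈ₘ z) fun x hx =>
      hlam.exists_bound hγ (fun η z => ∀ C, Maps f η C → z ∈ₘ C ∧ x ∈ₘ z) fun η hη => by
        obtain ⟨C, hC, hCu⟩ := hf.2 η hη
        obtain ⟨z, hz, hxz⟩ := (hfD η C hC).1.2.1 x hx
        refine ⟨z, (hfD η C hC).1.1 z hz, fun C' hC' => ?_⟩
        obtain rfl := hCu C' hC'
        exact ⟨hz, hxz⟩
  refine ⟨D, hD, fun δ hδ η hη => ?_⟩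
  obtain ⟨C, hC, -⟩ := hf.2 η hη
  obtain ⟨hlim, hcl⟩ := hDcl δ hδ
  refine (hfD η C hC).2 δ ((hfD η C hC).1.2.2 δ (hD.1 δ hδ) hlim fun x hx => ?_)
  obtain ⟨β, hβ, hβ'⟩ := hcl x hx
  obtain ⟨z, hz, hzC⟩ := hβ' η hη
  exact ⟨z, (hzC C hC).1, (hzC C hC).2, hlim.1.trans hz hβ⟩

/-- Taking the least witness needs no choice and keeps the value below `δ`. -/
theorem exists_regressive (D : M) (hD : ∀ δ, δ ∈ₘ D → IsOrd δ) (Q : M → M → Prop)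
    [Def M fun p : M × M => Q p.1 p.2] (h : ∀ δ, δ ∈ₘ D → ∃ v, v ∈ₘ δ ∧ Q δ v) :
    ∃ F, IsRegressiveOn F (elts D) ∧ ∀ δ v, Maps F δ v → Q δ v := by
  have inst : ∀ {α : Type u} [Ctx M α] (t s : α → M) [DefTerm M t] [DefTerm M s],
      Def M fun a => Q (t a) (s a) := fun t s => Def.comp₂ Q t s
  obtain ⟨F, hF, hFm⟩ := exists_graph D
    (fun δ v => v ∈ₘ δ ∧ Q δ v ∧ ∀ z, z ∈ₘ v → ¬ Q δ z) fun δ hδ => by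
      obtain ⟨v, hv, hQ⟩ := h δ hδ
      obtain ⟨m, hm, hQm, hle, hmin⟩ := ((hD δ hδ).mem hv).exists_least (fun z => Q δ z) hQ
      refine ⟨m, ⟨hle.trans_mem hv (hD δ hδ), hQm, hmin⟩, ?_⟩
      rintro n ⟨hn, hQn, hnmin⟩
      exact ((hD δ hδ).mem hn).eq_of_not_mem hm (fun h => hmin _ h hQn) fun h => hnmin _ h hQm
  exact ⟨F, ⟨hF, fun δ v h => ((hFm _ _).1 h).2.1⟩, fun δ v h => ((hFm _ _).1 h).2.2.1⟩

/-! ### Coding pairs of ordinals -/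

/-- For `η` below `γ < lam`, pairs `(ζ, η)` of ordinals below `lam` are coded injectively by
ordinals below `lam`: the code is the `η`-th ordinal from the `ζ`-th point on of a sufficiently
sparse club. -/
theorem exists_pair_coding {lam γ : M} (hlam : IsRegularUncountable lam) (hγ : γ ∈ₘ lam) :
    ∃ code : M → M → M → Prop, (Def M fun p : (M × M) × M => code p.1.1 p.1.2 p.2) ∧
      (∀ ζ η, ζ ∈ₘ lam → η ∈ₘ γ → ∃ v, v ∈ₘ lam ∧ code ζ η v) ∧
      ∀ ζ ζ' η η' v, η ∈ₘ γ → η' ∈ₘ γ → code ζ η v → code ζ' η' v → ζ = ζ' ∧ η = η' := by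
  -- `z` is in effect `x + η`, obtained as the `η`-th member of `lam \ x`.
  let shift : M → M → M → Prop := fun x η z =>
    ∃ b, (∀ y, y ∈ₘ b ↔ y ∈ₘ lam ∧ Le x y) ∧ IsNth b η z
  have hshift : ∀ x η, x ∈ₘ lam → η ∈ₘ γ → ∃ z, z ∈ₘ lam ∧ shift x η z := by
    intro x η hx hη
    obtain ⟨b, hb⟩ := exists_sep (fun y => Le x y) lam
    obtain ⟨z, hz⟩ := hlam.exists_isNth (c := b) (fun y hy => ((hb y).1 hy).1) (fun y hy => by
      rcases (hlam.1.mem hy).mem_or_le (hlam.1.mem hx) with h | h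
      · exact ⟨x, (hb x).2 ⟨hx, .inr rfl⟩, .inl h⟩
      · exact ⟨y, (hb y).2 ⟨hy, h⟩, .inr rfl⟩) (hlam.1.trans hη hγ)
    exact ⟨z, ((hb z).1 hz.1).1, b, hb, hz⟩
  have hshift_le : ∀ {x η z}, shift x η z → z ∈ₘ lam ∧ Le x z := fun ⟨b, hb, hz⟩ => (hb _).1 hz.1
  have hshift_inj : ∀ {x η η' z}, shift x η z → shift x η' z → η = η' := by
    rintro x η η' z ⟨b, hb, hz⟩ ⟨b', hb', hz'⟩
    obtain rfl : b = b' := ZFModel.extensionality _ _ fun y => (hb y).trans (hb' y).symm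
    exact hz.unique_index hz'
  have hshift_unique : ∀ {x η z z'}, shift x η z → shift x η z' → z = z' := by
    rintro x η z z' ⟨b, hb, hz⟩ ⟨b', hb', hz'⟩
    obtain rfl : b = b' := ZFModel.extensionality _ _ fun y => (hb y).trans (hb' y).symm
    exact hz.unique (hlam.1.mem ((hb z).1 hz.1).1) (hlam.1.mem ((hb z').1 hz'.1).1) hz'
  -- The block of the first `γ` ordinals from `e` on ends below any later member of `E`, so blocks
  -- of distinct members are disjoint and a code determines its block.
  obtain ⟨E, hE, hEcl⟩ := hlam.exists_club_closed
    (fun x β => ∀ η, η ∈ₘ γ → ∃ z, z ∈ₘ β ∧ ∃ b, (∀ y, y ∈ₘ b ↔ y ∈ₘ lam ∧ Le x y) ∧ IsNth b η z)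
    fun x hx => hlam.exists_bound hγ
      (fun η z => ∃ b, (∀ y, y ∈ₘ b ↔ y ∈ₘ lam ∧ Le x y) ∧ IsNth b η z) fun η hη => hshift x η hx hη
  have hlt : ∀ {e e' η z}, e' ∈ₘ E → e ∈ₘ e' → η ∈ₘ γ → shift e η z → z ∈ₘ e' := by
    intro e e' η z he' hee' hη hz
    obtain ⟨hlim, hcl⟩ := hEcl e' he'
    obtain ⟨β, hβ, hβ'⟩ := hcl e hee'
    obtain ⟨z', hz', hsh⟩ := hβ' η hη
    exact hshift_unique hz hsh ▸ hlim.1.trans hz' hβ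
  refine ⟨fun ζ η v => ∃ e, IsNth E ζ e ∧
    ∃ b, (∀ y, y ∈ₘ b ↔ y ∈ₘ lam ∧ Le e y) ∧ IsNth b η v, inferInstance, ?_, ?_⟩
  · intro ζ η hζ hη
    obtain ⟨e, he⟩ := hlam.exists_isNth hE.1
      (fun x hx => (hE.2.1 x hx).imp fun y hy => ⟨hy.1, .inl hy.2⟩) hζ
    obtain ⟨v, hv, hsh⟩ := hshift e η (hE.1 e he.1) hη
    exact ⟨v, hv, e, he, hsh⟩
  · rintro ζ ζ' η η' v hη hη' ⟨e, he, hv⟩ ⟨e', he', hv'⟩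
    obtain rfl : e = e' := (hlam.1.mem (hE.1 e he.1)).eq_of_not_mem (hlam.1.mem (hE.1 e' he'.1))
      (fun h => (hshift_le hv').2.not_mem (hlt he'.1 h hη hv))
      fun h => (hshift_le hv).2.not_mem (hlt he.1 h hη' hv')
    exact ⟨he.unique_index he', hshift_inj hv hv'⟩

/-! ### Ladder systems -/

section ladder

variable {lam θ γ c : M}

theorem IsLadderSystem.splitSet_subset (hc : IsLadderSystem lam θ γ c) (η α β : M) :
    splitSet c η α β ⊆ elts lam := by
  rintro δ ⟨d, hd, -⟩
  exact (hc.1.mem_dom hd).1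

/-- An index in `c_δ` is below its order type, hence below `γ`; so the `γ` many splitting sets
capture every ladder point. -/
theorem IsLadderSystem.mem_splitSet (hlam : IsOrd lam) (hγ : γ ∈ₘ lam)
    (hc : IsLadderSystem lam θ γ c) {α β δ d x η : M} (hd : Maps c δ d) (hx : IsNth d η x)
    (hαx : Le α x) (hxβ : x ∈ₘ β) : η ∈ₘ γ ∧ δ ∈ splitSet c η α β := by
  obtain ⟨-, τ, hτ, hτγ⟩ := hc.2 δ d hd
  obtain ⟨ξ, hξ, hot⟩ := hτ.exists_of_mem hx.1
  obtain rfl := hot.unique hx.2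
  exact ⟨mem_of_mem_of_le hξ hτγ (hlam.mem hγ), d, hd, ⟨τ, hτ, hξ⟩, x, hx, hαx, hxβ⟩

/-- Above `α < δ`, the ladder `c_δ` has a point. -/
theorem IsLadderSystem.exists_isNth (hlam : IsOrd lam) (hc : IsLadderSystem lam θ γ c) {α δ : M}
    (hδ : δ ∈ cofPoints lam θ) (hα : α ∈ₘ δ) :
    ∃ d x η, Maps c δ d ∧ IsNth d η x ∧ Le α x ∧ x ∈ₘ δ := by
  obtain ⟨d, hd, -⟩ := hc.1.2 δ hδ
  obtain ⟨x, hx, hαx⟩ := (hc.2 δ d hd).1.2 α hα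
  have hdδ := (hc.2 δ d hd).1.1
  obtain ⟨η, hη⟩ := ZFInternal.exists_isNth (fun y hy => (hlam.mem hδ.1).mem (hdδ y hy)) hx
  exact ⟨d, x, η, hd, hη, hαx, hdδ x hx⟩

/-- If for some `η < γ` the sets `S^η_{α,β}` are stationary for some `β` above any `α`, the ladder
system splits into stationary sets along a continuous sequence. -/
theorem IsLadderSystem.exists_sequence (hlam : IsRegularUncountable lam)
    (hc : IsLadderSystem lam θ γ c) {η : M}
    (h : ∀ α, α ∈ₘ lam → ∃ β, β ∈ₘ lam ∧ IsStationaryIn lam (splitSet c η α β)) :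
    ∃ s, IsContinuousIncreasing lam s ∧
      ∀ ξ ξ' α β, ξ ∈ₘ lam → IsSucc ξ' ξ → Maps s ξ α → Maps s ξ' β →
        IsStationaryIn lam (splitSet c η α β) := by
  obtain ⟨E, hE, hEcl⟩ := hlam.exists_club_closed
    (fun α β => IsStationaryIn lam (splitSet c η α β)) h
  obtain ⟨s, hs, hsE⟩ := hE.exists_enumeration hlam
  refine ⟨s, hs, fun ξ ξ' α β _ hξ' hα hβ => ?_⟩
  obtain ⟨hlim, hcl⟩ := hEcl β (hsE ξ' β hβ)
  -- Stationarity already occurs at some right endpoint below the next value and persists when it is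
  -- raised.
  obtain ⟨β', hβ', hst⟩ := hcl α (hs.2.1 ξ ξ' α β hα hβ ((hξ' ξ).2 (.inr rfl)))
  refine hst.mono ?_ (hc.splitSet_subset η α β)
  rintro δ ⟨d, hd, hτ, x, hx, hαx, hxβ⟩
  exact ⟨d, hd, hτ, x, hx, hαx, hlim.1.trans hxβ hβ'⟩

/-- If no `η < γ` splits the ladder system, this is witnessed uniformly above some `αstar`. -/
theorem IsLadderSystem.exists_uniform_bound (hlam : IsRegularUncountable lam) (hγ : γ ∈ₘ lam)
    (hc : IsLadderSystem lam θ γ c)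
    (h : ∀ η, η ∈ₘ γ → ∃ α, α ∈ₘ lam ∧ ∀ β, β ∈ₘ lam → ¬ IsStationaryIn lam (splitSet c η α β)) :
    ∃ αstar, αstar ∈ₘ lam ∧ ∀ η, η ∈ₘ γ → ∀ β, β ∈ₘ lam →
      ¬ IsStationaryIn lam (splitSet c η αstar β) := by
  obtain ⟨αstar, hα, hb⟩ := hlam.exists_bound hγ
    (fun η α => ∀ β, β ∈ₘ lam → ¬ IsStationaryIn lam (splitSet c η α β)) h
  refine ⟨αstar, hα, fun η hη β hβ hst => ?_⟩
  -- Raising the left endpoint from `α` to `αstar` only shrinks the splitting set.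
  obtain ⟨α, hlt, hns⟩ := hb η hη
  refine hns β hβ (hst.mono ?_ (hc.splitSet_subset η α β))
  rintro δ ⟨d, hd, hτ, x, hx, hαx, hxβ⟩
  have hxo : IsOrd x := (hlam.1.mem hβ).mem hxβ
  exact ⟨d, hd, hτ, x, hx, .inl (mem_of_mem_of_le hlt hαx hxo), hxβ⟩

/-- `F δ` is the least code below `δ` of a ladder point `x ≥ αstar` together with its index. Coding
the index as well confines a fiber to one splitting set, so no clubs have to be chosen. -/
theorem IsLadderSystem.exists_regressive_fibers (hlam : IsRegularUncountable lam) (hγ : γ ∈ₘ lam)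
    (hc : IsLadderSystem lam θ γ c) {αstar : M} (hα : αstar ∈ₘ lam)
    (hns : ∀ η, η ∈ₘ γ → ∀ β, β ∈ₘ lam → ¬ IsStationaryIn lam (splitSet c η αstar β)) :
    ∃ E F, IsClubIn lam E ∧ IsRegressiveOn F {δ | δ ∈ₘ E ∧ δ ∈ cofPoints lam θ} ∧
      ∀ β, ¬ IsStationaryIn lam {δ | Maps F δ β} := by
  obtain ⟨code, hdef, htot, hinj⟩ := exists_pair_coding hlam hγ
  have inst : ∀ {α : Type u} [Ctx M α] (t s r : α → M) [DefTerm M t] [DefTerm M s] [DefTerm M r],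
      Def M fun a => code (t a) (s a) (r a) := fun t s r =>
    Def.comp (fun p : (M × M) × M => code p.1.1 p.1.2 p.2) fun a => ((t a, s a), r a)
  -- Points of `E` exceed `αstar` and are closed under coding, which makes `F` regressive.
  obtain ⟨E, hE, hEcl⟩ := hlam.exists_club_closed
    (fun x β => αstar ∈ₘ β ∧ ∀ η, η ∈ₘ γ → ∃ v, v ∈ₘ β ∧ code x η v) fun x hx => by
      obtain ⟨β, hβ, hβv⟩ := hlam.exists_bound hγ (fun η v => code x η v)
        fun η hη => htot x η hx hη
      rcases (hlam.1.mem hα).mem_or_le (hlam.1.mem hβ) with h | h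
      · exact ⟨β, hβ, h, hβv⟩
      · obtain ⟨β', hβ', h'⟩ := hlam.exists_gt hα
        refine ⟨β', hβ', h', fun η hη => ?_⟩
        obtain ⟨v, hv, hcode⟩ := hβv η hη
        exact ⟨v, (hlam.1.mem hβ').trans hv (h.trans_mem h' (hlam.1.mem hβ')), hcode⟩
  have hdom : ∃ D : M, ∀ δ, δ ∈ₘ D ↔ δ ∈ₘ E ∧ δ ∈ cofPoints lam θ :=
    exists_sep (fun δ => δ ∈ₘ lam ∧ IsCof δ θ) E
  obtain ⟨D, hD⟩ := hdom
  obtain ⟨F, hF, hFQ⟩ := exists_regressive D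
    (fun δ hδ => hlam.1.mem (hE.1 δ ((hD δ).1 hδ).1))
    (fun δ v => ∃ d x η, (Maps c δ d ∧ IsNth d η x ∧ Le αstar x) ∧ x ∈ₘ δ ∧ code x η v)
    fun δ hδ => by
      obtain ⟨hδE, hδc⟩ := (hD δ).1 hδ
      obtain ⟨hlim, hcl⟩ := hEcl δ hδE
      obtain ⟨y, hy⟩ := hlim.2.1
      obtain ⟨β, hβ, hαβ, -⟩ := hcl y hy
      obtain ⟨d, x, η, hd, hx, hαx, hxδ⟩ :=
        hc.exists_isNth hlam.1 hδc (hlim.1.trans hαβ hβ)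
      obtain ⟨β', hβ', -, hv⟩ := hcl x hxδ
      obtain ⟨v, hv, hcode⟩ := hv η (hc.mem_splitSet hlam.1 hγ hd hx hαx hxδ).1
      exact ⟨v, hlim.1.trans hv hβ', d, x, η, ⟨hd, hx, hαx⟩, hxδ, hcode⟩
  have hDE : elts D = {δ | δ ∈ₘ E ∧ δ ∈ cofPoints lam θ} := Set.ext hD
  refine ⟨E, F, hE, hDE ▸ hF, fun β hst => ?_⟩
  -- One point of the fiber reveals `x` and `η`; injectivity of the code gives the same pair at all
  -- others.
  obtain ⟨δ₀, hδ₀E, hδ₀⟩ := hst.2 E hE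
  obtain ⟨d, x, η, ⟨hd, hx, hαx⟩, hxδ, hcode⟩ := hFQ _ _ hδ₀
  have hη := (hc.mem_splitSet hlam.1 hγ hd hx hαx hxδ).1
  obtain ⟨β', hβ', hxβ'⟩ := hlam.exists_gt (hlam.1.trans hxδ (hE.1 _ hδ₀E))
  refine hns η hη β' hβ' (hst.mono (fun δ hδ => ?_) (hc.splitSet_subset _ _ _))
  obtain ⟨d', x', η', ⟨hd', hx', hαx'⟩, hx'δ, hcode'⟩ := hFQ _ _ hδ
  obtain ⟨rfl, rfl⟩ := hinj _ _ _ _ _ hη (hc.mem_splitSet hlam.1 hγ hd' hx' hαx' hx'δ).1 hcode hcode'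
  exact (hc.mem_splitSet hlam.1 hγ hd' hx' hαx' hxβ').2

/-- `G δ` is the least ladder point at or above `αstar`. Its index varies with `δ`, so a club
missing all `γ` splitting sets at once is needed, and this is where choice enters. -/
theorem IsLadderSystem.exists_regressive_of_ac (hlam : IsRegularUncountable lam) (hγ : γ ∈ₘ lam)
    (hc : IsLadderSystem lam θ γ c) (hac : ACFor γ) {αstar : M}
    (hns : ∀ η, η ∈ₘ γ → ∀ β, β ∈ₘ lam → ¬ IsStationaryIn lam (splitSet c η αstar β)) :
    ∃ G, IsRegressiveOn G {δ | δ ∈ cofPoints lam θ ∧ αstar ∈ₘ δ} ∧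
      ∀ β, β ∈ₘ lam → ¬ IsStationaryIn lam {δ | ∃ x, Maps G δ x ∧ x ∈ₘ β} := by
  obtain ⟨D, hD⟩ := exists_sep (fun δ => IsCof δ θ ∧ αstar ∈ₘ δ) lam
  have hDc : elts D = {δ | δ ∈ cofPoints lam θ ∧ αstar ∈ₘ δ} :=
    Set.ext fun δ => (hD δ).trans and_assoc.symm
  obtain ⟨G, hG, hGQ⟩ := exists_regressive D (fun δ hδ => hlam.1.mem ((hD δ).1 hδ).1)
    (fun δ x => ∃ d η, Maps c δ d ∧ IsNth d η x ∧ Le αstar x) fun δ hδ => by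
      obtain ⟨hδl, hδc, hαδ⟩ := (hD δ).1 hδ
      obtain ⟨d, x, η, hd, hx, hαx, hxδ⟩ := hc.exists_isNth hlam.1 ⟨hδl, hδc⟩ hαδ
      exact ⟨x, hxδ, d, η, hd, hx, hαx⟩
  refine ⟨G, hDc ▸ hG, fun β hβ hst => ?_⟩
  obtain ⟨C, hC, hCA⟩ := exists_club_disjoint_of_ac hlam hγ hac
    (fun η => splitSet c η αstar β)
    fun η hη => exists_club_disjoint (hc.splitSet_subset _ _ _) (hns η hη β hβ)
  obtain ⟨δ, hδC, x, hx, hxβ⟩ := hst.2 C hC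
  obtain ⟨d, η, hd, hxd, hαx⟩ := hGQ _ _ hx
  obtain ⟨hη, hmem⟩ := hc.mem_splitSet hlam.1 hγ hd hxd hαx hxβ
  exact hCA δ hδC η hη hmem

end ladder

end Ladders

end ZFInternal

theorem theorem5p1 {M : Type*} [setLanguage.Structure M] [ZFModel M]
    (θ lam γ c : M)
    (hθ : IsRegularUncountable θ) (hlam : IsRegularUncountable lam) (hθlam : θ ∈ₘ lam)
    (hθγ : Le θ γ) (hγlam : γ ∈ₘ lam)
    (hc : IsLadderSystem lam θ γ c) :
    (∃ η s, η ∈ₘ γ ∧ IsContinuousIncreasing lam s ∧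
      ∀ ξ ξ' α β, ξ ∈ₘ lam → IsSucc ξ' ξ → Maps s ξ α → Maps s ξ' β →
        IsStationaryIn lam (splitSet c η α β)) ∨
    ((∃ E F, IsClubIn lam E ∧
        IsRegressiveOn F {δ | δ ∈ₘ E ∧ δ ∈ cofPoints lam θ} ∧
        ∀ β, β ∈ₘ lam → ¬ IsStationaryIn lam {δ | Maps F δ β}) ∧
      (ACFor γ →
        ∃ αstar G, αstar ∈ₘ lam ∧
          IsRegressiveOn G {δ | δ ∈ cofPoints lam θ ∧ αstar ∈ₘ δ} ∧
          ∀ β, β ∈ₘ lam → ¬ IsStationaryIn lam {δ | ∃ x, Maps G δ x ∧ x ∈ₘ β})) := by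
  by_cases h : ∃ η, η ∈ₘ γ ∧
      ∀ α, α ∈ₘ lam → ∃ β, β ∈ₘ lam ∧ IsStationaryIn lam (splitSet c η α β)
  · obtain ⟨η, hη, h⟩ := h
    obtain ⟨s, hs⟩ := hc.exists_sequence hlam h
    exact .inl ⟨η, s, hη, hs⟩
  · push Not at h
    obtain ⟨αstar, hα, hns⟩ := hc.exists_uniform_bound hlam hγlam h
    obtain ⟨E, F, hE, hF, hfib⟩ := hc.exists_regressive_fibers hlam hγlam hα hns
    refine .inr ⟨⟨E, F, hE, hF, fun β _ => hfib β⟩, fun hac => ?_⟩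
    obtain ⟨G, hG⟩ := hc.exists_regressive_of_ac hlam hγlam hac hns
    exact ⟨αstar, G, hα, hG⟩
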